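/- \textbf{Definitions.} Let $\mathbb D$ be the open unit disc, $\overline{\mathbb D}$ its closure and $\mathbb T$ the unit circle. The \emph{tetrablock} is $$\mathbb E=\{(x_1,x_2,x_3)\in\mathbb C^3:\ 1-x_1z-x_2w+x_3zw\neq 0\ \text{ whenever } |z|\le 1,\ |w|\le 1\},$$ $\overline{\mathbb E}$ is its closure, and $b\overline{\mathbb E}$ is its distinguished (Shilov) boundary: the smallest closed subset of $\overline{\mathbb E}$ on which every function that is continuous on $\overline{\mathbb E}$ and holomorphic on $\mathbb E$ attains its maximum modulus. An \emph{$\overline{\mathbb E}$-inner} (\emph{tetra-inner}) function is an analytic map $x=(x_1,x_2,x_3):\mathbb D\to\overline{\mathbb E}$ such that $\lim_{r\to1^-}x(r\lambda)$ exists and belongs to $b\overline{\mathbb E}$ for almost all $\lambda\in\mathbb T$ with respect to Lebesgue measure. It is \emph{rational} if $x_1,x_2,x_3$ are rational functions; it then extends continuously to $\overline{\mathbb D}$, the extension (again denoted by $x$) maps $\mathbb T$ into $b\overline{\mathbb E}$, and the \emph{degree} of $x$ is the integer $x_*(1)$, where $x_*:\mathbb Z=\pi_1(\mathbb T)\to\pi_1(b\overline{\mathbb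 E})\cong\mathbb Z$ is the homomorphism induced by $x|_{\mathbb T}$ and the identification $\pi_1(b\overline{\mathbb E})\cong\mathbb Z$ is chosen so that the degree is non-negative. For a polynomial $f$ of degree at most $n$ let $f^{\sim n}$ be the polynomial $f^{\sim n}(\lambda)=\lambda^n\,\overline{f(1/\overline\lambda)}$. \textbf{Theorem.} Let $n\ge 0$ be an integer. (a) Let $x=(x_1,x_2,x_3)$ be a rational $\overline{\mathbb E}$-inner function of degree $n$. Then there exist polynomials $E_1,E_2,D$ such that \begin{enumerate} \item $\deg(E_1),\deg(E_2),\deg(D)\le n$, \item $D(\lambda)\ne0$ on $\overline{\mathbb D}$, \item $x_3=D^{\sim n}/D$ on $\overline{\mathbb D}$, \item $x_1=E_1/D$ on $\overline{\mathbb D}$, \item $x_2=E_2/D$ on $\overline{\mathbb D}$, \item $|E_i(\lambda)|\le|D(\lambda)|$ on $\overline{\mathbb D}$ for $i=1,2$, \item $E_1(\lambda)=E_2^{\sim n}(\lambda)$ for $\lambda\in\overline{\mathbb D}$. \end{enumerate} (b) Furthermore, if $E_1,E_2,D$ satisfy (1)--(7) for the function $x$ of (a), then a triple of polynomials $E_1^1,E_2^1,D^1$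 satisfies (1)--(7) for $x$ if and only if there is a real number $t\ne0$ such that $E_1^1=tE_1$, $E_2^1=tE_2$ and $D^1=tD$. (c) Conversely, if polynomials $E_1,E_2,D$ satisfy (1), (6) and (7), $D(\lambda)\ne0$ on $\mathbb D$, and $x_1=E_1/D$, $x_2=E_2/D$, $x_3=D^{\sim n}/D$ on $\mathbb D$, then $x=(x_1,x_2,x_3)$ is a rational $\overline{\mathbb E}$-inner function of degree at most $n$. -/

import Mathlib

open Complex Set Filter Topology MeasureTheory Polynomial

/-- The open unit disc `𝔻` of `ℂ`. -/
abbrev unitDisc : Set ℂ := Metric.ball 0 1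

/-- The closed unit disc of `ℂ`. -/
abbrev closedUnitDisc : Set ℂ := Metric.closedBall 0 1

/-- The (open) tetrablock `𝔼 ⊆ ℂ³`: the points `(x₁, x₂, x₃)` such that
`1 - x₁ z - x₂ w + x₃ z w ≠ 0` whenever `|z| ≤ 1` and `|w| ≤ 1`. -/
def tetrablock : Set (ℂ × ℂ × ℂ) :=
  {x | ∀ z w : ℂ, ‖z‖ ≤ 1 → ‖w‖ ≤ 1 → 1 - x.1 * z - x.2.1 * w + x.2.2 * (z * w) ≠ 0}

/-- `C` is a closed boundary of `Ω`: a closed subset of the closure of `Ω` on which every function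
that is continuous on the closure of `Ω` and holomorphic on `Ω` attains its maximum modulus. -/
def IsClosedBoundary {V : Type*} [NormedAddCommGroup V] [NormedSpace ℂ V] (Ω C : Set V) : Prop :=
  IsClosed C ∧ C ⊆ closure Ω ∧
    ∀ f : V → ℂ, DiffContOnCl ℂ f Ω → ∃ c ∈ C, ∀ z ∈ closure Ω, ‖f z‖ ≤ ‖f c‖

/-- The distinguished (Shilov) boundary of the closure of `Ω`: the smallest closed boundary,
that is, the intersection of all closed boundaries. -/
def distinguishedBoundary {V : Type*} [NormedAddCommGroup V] [NormedSpace ℂ V] (Ω : Set V) :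
    Set V :=
  ⋂₀ {C | IsClosedBoundary Ω C}

/-- The distinguished boundary of the closed tetrablock. -/
abbrev tetraBoundary : Set (ℂ × ℂ × ℂ) := distinguishedBoundary tetrablock

/-- `x` (only its values on the open unit disc matter) is tetra-inner: an analytic map of the disc
into the closed tetrablock whose radial limits exist and lie in the distinguished boundary
at almost all points of the unit circle with respect to Lebesgue measure. -/
def IsTetraInner (x : ℂ → ℂ × ℂ × ℂ) : Prop :=
  DifferentiableOn ℂ x unitDisc ∧
  MapsTo x unitDisc (closure tetrablock) ∧
  ∀ᵐ θ : ℝ ∂(volume.restrict (Ioc 0 (2 * Real.pi))),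
    ∃ l ∈ tetraBoundary,
      Tendsto (fun r : ℝ => x (r * Complex.exp (θ * I))) (𝓝[<] 1) (𝓝 l)

/-- `f` is, on the open unit disc, a rational function (without poles there). -/
def IsRationalOnDisc (f : ℂ → ℂ) : Prop :=
  ∃ p q : ℂ[X], ∀ z ∈ unitDisc, q.eval z ≠ 0 ∧ f z = p.eval z / q.eval z

/-- Rational tetra-inner functions. -/
def IsRationalTetraInner (x : ℂ → ℂ × ℂ × ℂ) : Prop :=
  IsTetraInner x ∧
  IsRationalOnDisc (fun z => (x z).1) ∧
  IsRationalOnDisc (fun z => (x z).2.1) ∧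
  IsRationalOnDisc (fun z => (x z).2.2)

/-- The loop `t ↦ exp (2 π i t)` in the unit circle. -/
noncomputable def circleLoop : Path (1 : Circle) 1 where
  toFun t := Circle.exp (2 * Real.pi * (t : ℝ))
  continuous_toFun := by fun_prop
  source' := by simp
  target' := by simp

/-- The standard generator `1 ∈ ℤ = π₁(𝕋)`: the class of the identity map of the circle. -/
noncomputable def circleGenerator : FundamentalGroup Circle 1 :=
  FundamentalGroup.fromPath (Path.Homotopic.Quotient.mk circleLoop)

/-- The tetra-inner function `x` has degree `n`. Let `g : 𝕋 → bĒ` be the continuous map of radial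
limits of `x`, and `g_* : π₁(𝕋) → π₁(bĒ)` the homomorphism that it induces. Then `n = g_*(1)`
when `π₁(bĒ)` is identified with `ℤ`; of the two identifications, which differ by a sign, one is
taken that makes the degree non-negative. -/
def HasTetraDegree (x : ℂ → ℂ × ℂ × ℂ) (n : ℕ) : Prop :=
  ∃ g : C(Circle, tetraBoundary),
    (∀ ζ : Circle, Tendsto (fun r : ℝ => x (r * (ζ : ℂ))) (𝓝[<] 1) (𝓝 (g ζ : ℂ × ℂ × ℂ))) ∧
    ∃ φ : FundamentalGroup tetraBoundary (g 1) ≃* Multiplicative ℤ,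
      φ (FundamentalGroup.map g 1 circleGenerator) = Multiplicative.ofAdd (n : ℤ)

/-- The polynomial `f^{∼n}(z) = z ^ n * conj (f (1 / conj z))`, for `f` of degree at most `n`. -/
noncomputable def conjReflect (n : ℕ) (f : ℂ[X]) : ℂ[X] :=
  (f.map (starRingEnd ℂ)).reflect n

theorem eval_conjReflect (n : ℕ) (f : ℂ[X]) (hf : f.natDegree ≤ n) (z : ℂ) (hz : z ≠ 0) :
    (conjReflect n f).eval z
      = z ^ n * (starRingEnd ℂ) (f.eval (1 / (starRingEnd ℂ) z)) := by
  have h1 : (starRingEnd ℂ) (f.eval (1 / (starRingEnd ℂ) z))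
      = (f.map (starRingEnd ℂ)).eval z⁻¹ := by
    rw [← Polynomial.eval_map_apply]
    simp
  let _ : Invertible z⁻¹ := invertibleOfNonzero (inv_ne_zero hz)
  have h2 := Polynomial.eval₂_reflect_mul_pow (RingHom.id ℂ) z⁻¹ n (f.map (starRingEnd ℂ))
    ((Polynomial.natDegree_map_le).trans hf)
  simp only [invOf_eq_inv, inv_inv, Polynomial.eval₂_id] at h2
  rw [h1, ← h2, conjReflect, mul_comm _ ((z⁻¹) ^ n), ← mul_assoc, ← mul_pow, mul_inv_cancel₀ hz,
    one_pow, one_mul]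

/-- The function `f` on the open unit disc, extended by continuity to the closed unit disc, equals
`g` at every point of the closed disc. At points of the open disc this says `f z = g z`. -/
def ExtensionEqOnClosedDisc (f g : ℂ → ℂ) : Prop :=
  ∀ z ∈ closedUnitDisc, Tendsto f (𝓝[unitDisc] z) (𝓝 (g z))

/-- The polynomials `E₁, E₂, D` represent `x` as `(E₁ / D, E₂ / D, D^{∼n} / D)`, with all the
conditions on degrees, zeros, size and symmetry. -/
structure IsTetraRepresentation (n : ℕ) (x : ℂ → ℂ × ℂ × ℂ) (E₁ E₂ D : ℂ[X]) : Prop where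
  natDegree_E₁_le : E₁.natDegree ≤ n
  natDegree_E₂_le : E₂.natDegree ≤ n
  natDegree_D_le : D.natDegree ≤ n
  D_ne_zero : ∀ z ∈ closedUnitDisc, D.eval z ≠ 0
  x₃_eq : ExtensionEqOnClosedDisc (fun z => (x z).2.2)
    (fun z => (conjReflect n D).eval z / D.eval z)
  x₁_eq : ExtensionEqOnClosedDisc (fun z => (x z).1) (fun z => E₁.eval z / D.eval z)
  x₂_eq : ExtensionEqOnClosedDisc (fun z => (x z).2.1) (fun z => E₂.eval z / D.eval z)
  norm_E₁_le : ∀ z ∈ closedUnitDisc, ‖E₁.eval z‖ ≤ ‖D.eval z‖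
  norm_E₂_le : ∀ z ∈ closedUnitDisc, ‖E₂.eval z‖ ≤ ‖D.eval z‖
  E₁_eq : ∀ z ∈ closedUnitDisc, E₁.eval z = (conjReflect n E₂).eval z

open scoped ComplexConjugate unitInterval ContinuousMap

/-! ### Geometry of the tetrablock -/


/-! The distinguished boundary is `tetraTorus`: |x₃| = 1, |x₂| ≤ 1, x₁ = conj x₂ · x₃
(`tetraBoundary_eq`). The tetrablock is filled by the affine discs `tetraDisc`, whose boundary
circles lie in that set, so the maximum principle makes it a closed boundary; a peak polynomial at
each of its points shows that no closed boundary misses one. Shrinking x₁ and x₂ to 0 gives a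
homotopy equivalence with the circle through x₃, so the degree is, up to sign, the winding number of
x₃ on the circle.

For existence, x₃ in lowest terms is unimodular on the circle, hence a unimodular constant times
q^∼/q (`exists_eq_C_mul_conjReflect`), and a square root of the constant turns this into D^∼/D. The
relations x₁ = conj x₂ · x₃ and x₂ = conj x₁ · x₃ force the denominators of x₁ and x₂ to divide D
(`dvd_of_eval_div_eq`), and over D the first of them becomes E₁ = E₂^∼. Since D has no zero in the
closed disc, D^∼/D winds exactly as often as the index of the reflection, so this index is the
degree.

For uniqueness, D and D^∼ are coprime, so x₃ determines D up to a constant, which the reflection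
forces to be real. For the converse, a zero of D on the circle is shared by E₁, E₂ and D^∼ and
cancels, lowering n by one; once none is left, the maximum principle puts the quotients in the
closed tetrablock. -/

theorem tetrablock_swap {x : ℂ × ℂ × ℂ} (hx : x ∈ tetrablock) :
    ((x.2.1, x.1, x.2.2) : ℂ × ℂ × ℂ) ∈ tetrablock := by
  intro z w hz hw h
  apply hx w z hw hz
  simp only at h
  linear_combination h

theorem norm_fst_lt_of_mem_tetrablock {x : ℂ × ℂ × ℂ} (hx : x ∈ tetrablock) : ‖x.1‖ < 1 := by
  by_contra! h
  have h0 : x.1 ≠ 0 := fun h0 => by simp [h0] at h; linarith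
  refine hx x.1⁻¹ 0 ?_ (by simp) ?_
  · rw [norm_inv]; exact inv_le_one_of_one_le₀ h
  · simp [h0]

/-- Otherwise w = (1 - x₁z)/(x₂ - x₃z) would lie in the closed disc and annihilate the defining
form. -/
theorem norm_sub_mul_lt_of_mem_tetrablock {x : ℂ × ℂ × ℂ} (hx : x ∈ tetrablock) {z : ℂ}
    (hz : ‖z‖ ≤ 1) : ‖x.2.1 - x.2.2 * z‖ < ‖1 - x.1 * z‖ := by
  by_contra! h
  have ha : 1 - x.1 * z ≠ 0 := by simpa using hx z 0 hz (by simp)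
  have hb : x.2.1 - x.2.2 * z ≠ 0 := norm_pos_iff.1 ((norm_pos_iff.2 ha).trans_le h)
  refine hx z ((1 - x.1 * z) / (x.2.1 - x.2.2 * z)) hz ?_ ?_
  · rw [norm_div]; exact div_le_one_of_le₀ h (norm_nonneg _)
  · linear_combination -div_mul_cancel₀ (1 - x.1 * z) hb

theorem exists_norm_eq_one_mul_eq_norm (u : ℂ) : ∃ z : ℂ, ‖z‖ = 1 ∧ z * u = ‖u‖ := by
  by_cases hu : u = 0
  · exact ⟨1, by simp, by simp [hu]⟩
  · have hn : (‖u‖ : ℂ) ≠ 0 := by simpa using hu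
    refine ⟨conj u / ‖u‖, ?_, ?_⟩
    · simp [hu]
    · rw [div_mul_eq_mul_div, div_eq_iff hn, mul_comm, mul_conj, normSq_eq_norm_sq]
      push_cast; ring

/-- This is |x₂ - x₃z|² < |1 - x₁z|² at the point z of the circle that rotates x₁ - conj x₂ · x₃
onto the positive axis, where the inequality is sharpest. Adding the version with x₁ and x₂
exchanged then cancels |x₁|² and |x₂|². -/
theorem two_mul_norm_lt_of_mem_tetrablock {x : ℂ × ℂ × ℂ} (hx : x ∈ tetrablock) :
    2 * ‖x.1 - conj x.2.1 * x.2.2‖ < 1 + ‖x.1‖ ^ 2 - ‖x.2.1‖ ^ 2 - ‖x.2.2‖ ^ 2 := by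
  obtain ⟨z, hz, hzu⟩ := exists_norm_eq_one_mul_eq_norm (x.1 - conj x.2.1 * x.2.2)
  have h := norm_sub_mul_lt_of_mem_tetrablock hx hz.le
  have h2 : ‖x.2.1 - x.2.2 * z‖ ^ 2 < ‖1 - x.1 * z‖ ^ 2 := by gcongr
  have hzz : z * conj z = 1 := by rw [mul_conj, normSq_eq_norm_sq, hz]; simp
  have hzu' := congrArg conj hzu
  simp only [map_mul, map_sub, conj_conj, conj_ofReal] at hzu'
  have key : ((‖1 - x.1 * z‖ ^ 2 - ‖x.2.1 - x.2.2 * z‖ ^ 2 : ℝ) : ℂ)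
      = ((1 + ‖x.1‖ ^ 2 - ‖x.2.1‖ ^ 2 - ‖x.2.2‖ ^ 2
        - 2 * ‖x.1 - conj x.2.1 * x.2.2‖ : ℝ) : ℂ) := by
    push_cast
    simp only [← mul_conj', map_sub, map_one, map_mul]
    linear_combination (x.1 * conj x.1 - x.2.2 * conj x.2.2) * hzz - hzu - hzu'
  have := ofReal_injective key
  linarith

theorem norm_add_norm_lt_of_mem_tetrablock {x : ℂ × ℂ × ℂ} (hx : x ∈ tetrablock) :
    ‖x.1 - conj x.2.1 * x.2.2‖ + ‖x.2.1 - conj x.1 * x.2.2‖ < 1 - ‖x.2.2‖ ^ 2 := by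
  have h1 := two_mul_norm_lt_of_mem_tetrablock hx
  have h2 := two_mul_norm_lt_of_mem_tetrablock (tetrablock_swap hx)
  simp only at h2
  linarith

theorem norm_add_norm_le_of_mem_closure_tetrablock {x : ℂ × ℂ × ℂ} (hx : x ∈ closure tetrablock) :
    ‖x.1 - conj x.2.1 * x.2.2‖ + ‖x.2.1 - conj x.1 * x.2.2‖ ≤ 1 - ‖x.2.2‖ ^ 2 := by
  refine closure_minimal (t := {x : ℂ × ℂ × ℂ | ‖x.1 - conj x.2.1 * x.2.2‖
    + ‖x.2.1 - conj x.1 * x.2.2‖ ≤ 1 - ‖x.2.2‖ ^ 2})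
    (fun y hy => (norm_add_norm_lt_of_mem_tetrablock hy).le) ?_ hx
  apply isClosed_le <;> fun_prop

theorem norm_fst_le_of_mem_closure_tetrablock {x : ℂ × ℂ × ℂ} (hx : x ∈ closure tetrablock) :
    ‖x.1‖ ≤ 1 := by
  refine closure_minimal (t := {x : ℂ × ℂ × ℂ | ‖x.1‖ ≤ 1})
    (fun y hy => (norm_fst_lt_of_mem_tetrablock hy).le) ?_ hx
  apply isClosed_le <;> fun_prop

theorem norm_snd_le_of_mem_closure_tetrablock {x : ℂ × ℂ × ℂ} (hx : x ∈ closure tetrablock) :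
    ‖x.2.1‖ ≤ 1 := by
  refine closure_minimal (t := {x : ℂ × ℂ × ℂ | ‖x.2.1‖ ≤ 1})
    (fun y hy => (norm_fst_lt_of_mem_tetrablock (tetrablock_swap hy)).le) ?_ hx
  apply isClosed_le <;> fun_prop

theorem norm_trd_le_of_mem_closure_tetrablock {x : ℂ × ℂ × ℂ} (hx : x ∈ closure tetrablock) :
    ‖x.2.2‖ ≤ 1 := by
  have h := norm_add_norm_le_of_mem_closure_tetrablock hx
  nlinarith [norm_nonneg (x.1 - conj x.2.1 * x.2.2), norm_nonneg (x.2.1 - conj x.1 * x.2.2),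
    norm_nonneg x.2.2]

/-- The points (r x₁, r x₂, r² x₃) with r < 1 lie in the tetrablock, because their form at (z, w) is
the form of x at (rz, rw). -/
theorem mem_closure_tetrablock_of_forall_ne_zero {x : ℂ × ℂ × ℂ}
    (hx : ∀ z w : ℂ, ‖z‖ < 1 → ‖w‖ < 1 → 1 - x.1 * z - x.2.1 * w + x.2.2 * (z * w) ≠ 0) :
    x ∈ closure tetrablock := by
  let s : ℝ → ℂ × ℂ × ℂ := fun r => (r * x.1, r * x.2.1, r ^ 2 * x.2.2)
  have hs : Tendsto s (𝓝[<] 1) (𝓝 x) := by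
    have : Continuous s := by fun_prop
    have h := this.tendsto 1
    simp only [s, ofReal_one, one_mul, one_pow] at h
    exact h.mono_left nhdsWithin_le_nhds
  refine mem_closure_of_tendsto hs ?_
  filter_upwards [Ioo_mem_nhdsLT (zero_lt_one' ℝ)] with r hr z w hz hw h
  have aux : ∀ z : ℂ, ‖z‖ ≤ 1 → ‖r * z‖ < 1 := fun z hz => by
    rw [norm_mul, norm_real, Real.norm_of_nonneg hr.1.le]
    nlinarith [hr.1, hr.2, norm_nonneg z]
  apply hx (r * z) (r * w) (aux z hz) (aux w hw)
  simp only [s] at h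
  linear_combination h

/-- The set of points of the closed tetrablock with `|x₃| = 1`. -/
def tetraTorus : Set (ℂ × ℂ × ℂ) :=
  {x | x.1 = conj x.2.1 * x.2.2 ∧ ‖x.2.2‖ = 1 ∧ ‖x.2.1‖ ≤ 1}

theorem mul_conj_eq_one_of_norm_eq_one {z : ℂ} (hz : ‖z‖ = 1) : z * conj z = 1 := by
  rw [mul_conj', hz]; simp

theorem snd_eq_of_mem_tetraTorus {x : ℂ × ℂ × ℂ} (hx : x ∈ tetraTorus) :
    x.2.1 = conj x.1 * x.2.2 := by
  rw [hx.1, map_mul, conj_conj]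
  linear_combination -x.2.1 * mul_conj_eq_one_of_norm_eq_one hx.2.1

theorem norm_fst_of_mem_tetraTorus {x : ℂ × ℂ × ℂ} (hx : x ∈ tetraTorus) : ‖x.1‖ = ‖x.2.1‖ := by
  rw [hx.1, norm_mul, hx.2.1, RCLike.norm_conj, mul_one]

/-- The difference of the squares factors as (1 - |a|²)(1 - |z|²). -/
theorem norm_sub_conj_le {a z : ℂ} (ha : ‖a‖ ≤ 1) (hz : ‖z‖ ≤ 1) :
    ‖z - conj a‖ ≤ ‖1 - a * z‖ := by
  rw [← sq_le_sq₀ (norm_nonneg _) (norm_nonneg _)]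
  have key : ((‖1 - a * z‖ ^ 2 - ‖z - conj a‖ ^ 2 : ℝ) : ℂ)
      = (((1 - ‖a‖ ^ 2) * (1 - ‖z‖ ^ 2) : ℝ) : ℂ) := by
    push_cast
    simp only [← mul_conj', map_sub, map_one, map_mul, conj_conj]
    ring
  have := ofReal_injective key
  have h1 : 0 ≤ 1 - ‖a‖ ^ 2 := by nlinarith [norm_nonneg a]
  have h2 : 0 ≤ 1 - ‖z‖ ^ 2 := by nlinarith [norm_nonneg z]
  nlinarith [mul_nonneg h1 h2]

theorem norm_sub_mul_le_of_mem_tetraTorus {x : ℂ × ℂ × ℂ} (hx : x ∈ tetraTorus) {z : ℂ}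
    (hz : ‖z‖ ≤ 1) : ‖x.2.1 - x.2.2 * z‖ ≤ ‖1 - x.1 * z‖ := by
  have h : x.2.1 - x.2.2 * z = -(x.2.2 * (z - conj x.1)) := by
    linear_combination snd_eq_of_mem_tetraTorus hx
  rw [h, norm_neg, norm_mul, hx.2.1, one_mul]
  exact norm_sub_conj_le ((norm_fst_of_mem_tetraTorus hx).le.trans hx.2.2) hz

theorem mem_closure_tetrablock_of_norm_le {x : ℂ × ℂ × ℂ} (h1 : ‖x.1‖ ≤ 1)
    (h : ∀ z : ℂ, ‖z‖ < 1 → ‖x.2.1 - x.2.2 * z‖ ≤ ‖1 - x.1 * z‖) : x ∈ closure tetrablock := by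
  refine mem_closure_tetrablock_of_forall_ne_zero fun z w hz hw h0 => ?_
  have h2 : 1 - x.1 * z = w * (x.2.1 - x.2.2 * z) := by linear_combination h0
  have h3 : ‖1 - x.1 * z‖ = 0 := by
    have h4 := h z hz
    have h5 := congrArg norm h2
    rw [norm_mul] at h5
    nlinarith [norm_nonneg (1 - x.1 * z), norm_nonneg (x.2.1 - x.2.2 * z), norm_nonneg w]
  have h6 : ‖x.1 * z‖ = 1 := by
    rw [← sub_eq_zero.1 (norm_eq_zero.1 h3), norm_one]
  rw [norm_mul] at h6
  nlinarith [norm_nonneg z, norm_nonneg x.1]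

theorem tetraTorus_subset_closure_tetrablock : tetraTorus ⊆ closure tetrablock := fun _ hx =>
  mem_closure_tetrablock_of_norm_le ((norm_fst_of_mem_tetraTorus hx).le.trans hx.2.2)
    fun _ hz => norm_sub_mul_le_of_mem_tetraTorus hx hz.le

theorem mem_tetraTorus_of_norm_trd_eq_one {x : ℂ × ℂ × ℂ} (hx : x ∈ closure tetrablock)
    (h : ‖x.2.2‖ = 1) : x ∈ tetraTorus := by
  have h1 := norm_add_norm_le_of_mem_closure_tetrablock hx
  refine ⟨sub_eq_zero.1 (norm_eq_zero.1 ?_), h, norm_snd_le_of_mem_closure_tetrablock hx⟩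
  rw [h] at h1
  linarith [norm_nonneg (x.1 - conj x.2.1 * x.2.2), norm_nonneg (x.2.1 - conj x.1 * x.2.2)]

theorem isClosed_tetraTorus : IsClosed tetraTorus := by
  have h : tetraTorus = {x | x.1 = conj x.2.1 * x.2.2} ∩ ({x | ‖x.2.2‖ = 1} ∩ {x | ‖x.2.1‖ ≤ 1}) :=
    rfl
  rw [h]
  refine (isClosed_eq ?_ ?_).inter ((isClosed_eq ?_ ?_).inter (isClosed_le ?_ ?_)) <;> fun_prop

theorem isCompact_tetraTorus : IsCompact tetraTorus := by
  refine Metric.isCompact_of_isClosed_isBounded isClosed_tetraTorus ?_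
  refine (Metric.isBounded_closedBall (x := (0 : ℂ × ℂ × ℂ)) (r := 1)).subset fun x hx => ?_
  rw [mem_closedBall_zero_iff, Prod.norm_def, Prod.norm_def]
  exact max_le ((norm_fst_of_mem_tetraTorus hx).le.trans hx.2.2) (max_le hx.2.2 hx.2.1.le)

/-- An affine disc in the closed tetrablock with boundary in `tetraTorus`. -/
noncomputable def tetraDisc (b c : ℂ) (l : ℂ) : ℂ × ℂ × ℂ :=
  (b + conj c * l, c + conj b * l, l)

theorem differentiable_tetraDisc (b c : ℂ) : Differentiable ℂ (tetraDisc b c) := by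
  unfold tetraDisc; fun_prop

theorem tetraDisc_mem_tetraTorus {b c l : ℂ} (h : ‖b‖ + ‖c‖ ≤ 1) (hl : ‖l‖ = 1) :
    tetraDisc b c l ∈ tetraTorus := by
  refine ⟨?_, hl, ?_⟩
  · simp only [tetraDisc, map_add, map_mul, conj_conj]
    linear_combination -b * mul_conj_eq_one_of_norm_eq_one hl
  · calc ‖c + conj b * l‖ ≤ ‖c‖ + ‖conj b * l‖ := norm_add_le _ _
      _ = ‖c‖ + ‖b‖ := by rw [norm_mul, hl, RCLike.norm_conj, mul_one]
      _ ≤ 1 := by linarith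

/-- The defining form at `tetraDisc b c l` is (1 - bz - cw) + l(zw - conj c · z - conj b · w); the
bound makes the first term dominate when |l| < 1. -/
theorem norm_le_norm_one_sub_sub {b c z w : ℂ} (h : ‖b‖ + ‖c‖ ≤ 1) (hz : ‖z‖ ≤ 1)
    (hw : ‖w‖ ≤ 1) : ‖z * w - conj c * z - conj b * w‖ ≤ ‖1 - b * z - c * w‖ := by
  rw [← sq_le_sq₀ (norm_nonneg _) (norm_nonneg _)]
  have key : ‖1 - b * z - c * w‖ ^ 2 - ‖z * w - conj c * z - conj b * w‖ ^ 2
      = 1 - ‖z‖ ^ 2 * ‖w‖ ^ 2 + (‖b‖ ^ 2 - ‖c‖ ^ 2) * (‖z‖ ^ 2 - ‖w‖ ^ 2)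
        - 2 * (b * z).re * (1 - ‖w‖ ^ 2) - 2 * (c * w).re * (1 - ‖z‖ ^ 2) := by
    simp only [← normSq_eq_norm_sq, normSq_apply, sub_re, sub_im, mul_re, mul_im, conj_re, conj_im,
      one_re, one_im]
    ring
  have h1 : (b * z).re ≤ ‖b‖ * ‖z‖ := (re_le_norm _).trans (norm_mul _ _).le
  have h2 : (c * w).re ≤ ‖c‖ * ‖w‖ := (re_le_norm _).trans (norm_mul _ _).le
  have hb := norm_nonneg b
  have hc := norm_nonneg c
  have hz0 := norm_nonneg z
  have hw0 := norm_nonneg w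
  generalize ‖b‖ = β at *
  generalize ‖c‖ = γ at *
  generalize ‖z‖ = r at *
  generalize ‖w‖ = s at *
  have hP : 0 ≤ 1 - r ^ 2 := by nlinarith
  have hQ : 0 ≤ 1 - s ^ 2 := by nlinarith
  -- With P = 1 - r² and Q = 1 - s², 2r ≤ 1 + r² = 2 - P and likewise for s, which makes the lower
  -- bound polynomial in P and Q.
  have e1 : 2 * r ≤ 2 - (1 - r ^ 2) := by nlinarith [sq_nonneg (1 - r)]
  have e2 : 2 * s ≤ 2 - (1 - s ^ 2) := by nlinarith [sq_nonneg (1 - s)]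
  have f1 : 2 * (b * z).re * (1 - s ^ 2) ≤ β * (2 - (1 - r ^ 2)) * (1 - s ^ 2) := by
    apply mul_le_mul_of_nonneg_right _ hQ; nlinarith
  have f2 : 2 * (c * w).re * (1 - r ^ 2) ≤ γ * (2 - (1 - s ^ 2)) * (1 - r ^ 2) := by
    apply mul_le_mul_of_nonneg_right _ hP; nlinarith
  have hP1 : 1 - r ^ 2 ≤ 1 := by nlinarith
  have hQ1 : 1 - s ^ 2 ≤ 1 := by nlinarith
  have e : r ^ 2 = 1 - (1 - r ^ 2) := by ring
  have e' : s ^ 2 = 1 - (1 - s ^ 2) := by ring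
  generalize 1 - r ^ 2 = P at *
  generalize 1 - s ^ 2 = Q at *
  -- This product is exactly what remains of `key` after the bounds `f1` and `f2`.
  have g : 0 ≤ (1 - β - γ) * (Q * (1 - β + γ) + P * (1 - γ + β) - P * Q) := by
    apply mul_nonneg (by linarith)
    nlinarith [mul_nonneg hP hQ, mul_nonneg hP hb, mul_nonneg hQ hc, mul_nonneg hP hc,
      mul_nonneg hQ hb, mul_nonneg hP (sub_nonneg.2 hQ1), mul_nonneg hQ (sub_nonneg.2 hP1)]
  rw [e, e'] at key
  nlinarith

theorem tetraDisc_mem_tetrablock {b c l : ℂ} (h : ‖b‖ + ‖c‖ < 1) (hl : ‖l‖ < 1) :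
    tetraDisc b c l ∈ tetrablock := by
  intro z w hz hw h0
  have hle := norm_le_norm_one_sub_sub h.le hz hw
  have h1 : 1 - b * z - c * w = -(l * (z * w - conj c * z - conj b * w)) := by
    simp only [tetraDisc] at h0
    linear_combination h0
  have h2 := congrArg norm h1
  rw [norm_neg, norm_mul] at h2
  have h3 : ‖1 - b * z - c * w‖ = 0 := by
    nlinarith [norm_nonneg (1 - b * z - c * w), norm_nonneg (z * w - conj c * z - conj b * w),
      norm_nonneg l]
  have h4 : b * z + c * w = 1 := by linear_combination - norm_eq_zero.1 h3
  have h5 : ‖b * z + c * w‖ ≤ ‖b‖ * ‖z‖ + ‖c‖ * ‖w‖ := by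
    simpa only [norm_mul] using norm_add_le (b * z) (c * w)
  rw [h4, norm_one] at h5
  nlinarith [norm_nonneg b, norm_nonneg c]

/-- Together with the conjugate equations, x₁ = b + conj c · x₃ and x₂ = c + conj b · x₃ form a
linear system with determinant 1 - |x₃|². -/
theorem exists_eq_tetraDisc {x : ℂ × ℂ × ℂ} (hx : ‖x.2.2‖ < 1) :
    ∃ b c : ℂ, x = tetraDisc b c x.2.2 ∧ (1 - ‖x.2.2‖ ^ 2) * (‖b‖ + ‖c‖)
      = ‖x.1 - conj x.2.1 * x.2.2‖ + ‖x.2.1 - conj x.1 * x.2.2‖ := by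
  have hpos : 0 < 1 - ‖x.2.2‖ ^ 2 := by nlinarith [norm_nonneg x.2.2]
  have hd : (1 - x.2.2 * conj x.2.2) ≠ 0 := by
    rw [mul_conj']; exact_mod_cast hpos.ne'
  have hcd : conj (1 - x.2.2 * conj x.2.2) = 1 - x.2.2 * conj x.2.2 := by
    simp only [map_sub, map_one, map_mul, conj_conj]; ring
  have hnd : ‖1 - x.2.2 * conj x.2.2‖ = 1 - ‖x.2.2‖ ^ 2 := by
    have : 1 - x.2.2 * conj x.2.2 = ((1 - ‖x.2.2‖ ^ 2 : ℝ) : ℂ) := by rw [mul_conj']; push_cast; rfl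
    rw [this, norm_real, Real.norm_of_nonneg hpos.le]
  refine ⟨(x.1 - conj x.2.1 * x.2.2) / (1 - x.2.2 * conj x.2.2),
    (x.2.1 - conj x.1 * x.2.2) / (1 - x.2.2 * conj x.2.2), ?_, ?_⟩
  · simp only [tetraDisc, map_div₀, hcd]
    simp only [map_sub, map_mul, conj_conj]
    ext
    · simp only; field_simp; ring
    · simp only; field_simp; ring
    · simp
  · rw [norm_div, norm_div, hnd]; field_simp

theorem mapsTo_tetraDisc_closedBall {b c : ℂ} (h : ‖b‖ + ‖c‖ < 1) :
    MapsTo (tetraDisc b c) closedUnitDisc (closure tetrablock) := by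
  intro l hl
  rcases (mem_closedBall_zero_iff.1 hl).lt_or_eq with hl | hl
  · exact subset_closure (tetraDisc_mem_tetrablock h hl)
  · exact tetraTorus_subset_closure_tetrablock (tetraDisc_mem_tetraTorus h.le hl)

theorem exists_tetraDisc_of_mem_tetrablock {x : ℂ × ℂ × ℂ} (hx : x ∈ tetrablock) :
    ‖x.2.2‖ < 1 ∧ ∃ b c : ℂ, x = tetraDisc b c x.2.2 ∧ ‖b‖ + ‖c‖ < 1 := by
  have h := norm_add_norm_lt_of_mem_tetrablock hx
  have h3 : ‖x.2.2‖ < 1 := by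
    nlinarith [norm_nonneg (x.1 - conj x.2.1 * x.2.2), norm_nonneg (x.2.1 - conj x.1 * x.2.2),
      norm_nonneg x.2.2]
  obtain ⟨b, c, hbc, he⟩ := exists_eq_tetraDisc h3
  refine ⟨h3, b, c, hbc, ?_⟩
  have hpos : 0 < 1 - ‖x.2.2‖ ^ 2 := by nlinarith [norm_nonneg x.2.2]
  rw [← he] at h
  by_contra! h1
  nlinarith

/-! ### Determination of the distinguished boundary -/

/-- The maximum principle applies on the affine disc through each point of the tetrablock, and
continuity carries the bound to the closure. -/
theorem norm_le_of_forall_tetraTorus_norm_le {f : ℂ × ℂ × ℂ → ℂ}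
    (hf : DiffContOnCl ℂ f tetrablock) {M : ℝ} (hM : ∀ y ∈ tetraTorus, ‖f y‖ ≤ M)
    {x : ℂ × ℂ × ℂ} (hx : x ∈ closure tetrablock) : ‖f x‖ ≤ M := by
  refine closure_minimal (t := closure tetrablock ∩ f ⁻¹' Metric.closedBall 0 M) ?_
    (hf.continuousOn.preimage_isClosed_of_isClosed isClosed_closure Metric.isClosed_closedBall) hx
    |>.2 |> mem_closedBall_zero_iff.1
  intro y hy
  refine ⟨subset_closure hy, mem_closedBall_zero_iff.2 ?_⟩
  obtain ⟨h3, b, c, hy', hbc⟩ := exists_tetraDisc_of_mem_tetrablock hy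
  have hd : DiffContOnCl ℂ (f ∘ tetraDisc b c) (Metric.ball (0 : ℂ) 1) := by
    refine ⟨?_, ?_⟩
    · refine hf.differentiableOn.comp (differentiable_tetraDisc b c).differentiableOn fun l hl => ?_
      exact tetraDisc_mem_tetrablock hbc (mem_ball_zero_iff.1 hl)
    · rw [closure_ball _ one_ne_zero]
      exact hf.continuousOn.comp (differentiable_tetraDisc b c).continuous.continuousOn
        (mapsTo_tetraDisc_closedBall hbc)
  have h := Complex.norm_le_of_forall_mem_frontier_norm_le (z := y.2.2) Metric.isBounded_ball hd
    (C := M) ?_ (subset_closure (mem_ball_zero_iff.2 h3))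
  · rwa [Function.comp_apply, ← hy'] at h
  · intro l hl
    rw [frontier_ball _ one_ne_zero, mem_sphere_zero_iff_norm] at hl
    exact hM _ (tetraDisc_mem_tetraTorus hbc.le hl)

theorem isClosedBoundary_tetraTorus : IsClosedBoundary tetrablock tetraTorus := by
  refine ⟨isClosed_tetraTorus, tetraTorus_subset_closure_tetrablock, fun f hf => ?_⟩
  obtain ⟨c, hc, hmax⟩ := isCompact_tetraTorus.exists_isMaxOn
    ⟨((0, 0, 1) : ℂ × ℂ × ℂ), by simp [tetraTorus]⟩
    (hf.continuousOn.mono tetraTorus_subset_closure_tetrablock).norm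
  exact ⟨c, hc, fun z hz => norm_le_of_forall_tetraTorus_norm_le hf (fun y hy => hmax hy) hz⟩

/-- A polynomial that peaks at the point `p` of `tetraTorus`. -/
noncomputable def tetraPeak (p x : ℂ × ℂ × ℂ) : ℂ :=
  8 + conj p.2.2 * (8 * x.2.2 -
    (x.1 * x.2.1 - conj p.2.1 * (x.2.1 * x.2.2) - p.2.1 * x.1 + p.2.1 * conj p.2.1 * x.2.2))

theorem differentiable_tetraPeak (p : ℂ × ℂ × ℂ) : Differentiable ℂ (tetraPeak p) := by
  unfold tetraPeak; fun_prop

/-- Substituting x₁ = conj x₂ · x₃ turns the bracket of `tetraPeak` into x₃|x₂ - p₂|². As |x₂ - p₂|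
≤ 2, the real factor is positive and largest only at x₂ = p₂. -/
theorem tetraPeak_of_mem_tetraTorus (p : ℂ × ℂ × ℂ) {x : ℂ × ℂ × ℂ} (hx : x ∈ tetraTorus) :
    tetraPeak p x = 8 + conj p.2.2 * x.2.2 * ((8 - ‖x.2.1 - p.2.1‖ ^ 2 : ℝ) : ℂ) := by
  push_cast
  rw [← mul_conj', tetraPeak, hx.1, map_sub]
  ring

theorem norm_tetraPeak_self {p : ℂ × ℂ × ℂ} (hp : p ∈ tetraTorus) : ‖tetraPeak p p‖ = 16 := by
  rw [tetraPeak_of_mem_tetraTorus p hp, mul_comm (conj p.2.2),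
    mul_conj_eq_one_of_norm_eq_one hp.2.1, sub_self, norm_zero]
  norm_num

theorem norm_tetraPeak_le {p x : ℂ × ℂ × ℂ} (hp : p ∈ tetraTorus) (hx : x ∈ tetraTorus) :
    ‖tetraPeak p x‖ ≤ 16 := by
  rw [tetraPeak_of_mem_tetraTorus p hx]
  have h1 : ‖x.2.1 - p.2.1‖ ≤ 2 := (norm_sub_le _ _).trans (by linarith [hp.2.2, hx.2.2])
  have h2 : 0 ≤ 8 - ‖x.2.1 - p.2.1‖ ^ 2 := by nlinarith [norm_nonneg (x.2.1 - p.2.1)]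
  refine (norm_add_le _ _).trans ?_
  rw [norm_mul, norm_mul, RCLike.norm_conj, hp.2.1, hx.2.1, norm_real, Real.norm_of_nonneg h2]
  norm_num
  nlinarith [norm_nonneg (x.2.1 - p.2.1)]

theorem eq_of_norm_tetraPeak_eq {p x : ℂ × ℂ × ℂ} (hp : p ∈ tetraTorus) (hx : x ∈ tetraTorus)
    (h : ‖tetraPeak p x‖ = 16) : x = p := by
  rw [tetraPeak_of_mem_tetraTorus p hx] at h
  have h1 : ‖x.2.1 - p.2.1‖ ≤ 2 := (norm_sub_le _ _).trans (by linarith [hp.2.2, hx.2.2])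
  have h2 : 0 ≤ 8 - ‖x.2.1 - p.2.1‖ ^ 2 := by nlinarith [norm_nonneg (x.2.1 - p.2.1)]
  have h3 : ‖8 + conj p.2.2 * x.2.2 * ((8 - ‖x.2.1 - p.2.1‖ ^ 2 : ℝ) : ℂ)‖
      ≤ 8 + (8 - ‖x.2.1 - p.2.1‖ ^ 2) := by
    refine (norm_add_le _ _).trans ?_
    rw [norm_mul, norm_mul, RCLike.norm_conj, hp.2.1, hx.2.1, norm_real, Real.norm_of_nonneg h2]
    norm_num
  have h4 : x.2.1 = p.2.1 := by
    have : ‖x.2.1 - p.2.1‖ = 0 := by nlinarith [norm_nonneg (x.2.1 - p.2.1)]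
    exact sub_eq_zero.1 (norm_eq_zero.1 this)
  have h5 : conj p.2.2 * x.2.2 = 1 := by
    rw [h4, sub_self, norm_zero] at h
    have hu : ‖conj p.2.2 * x.2.2‖ = 1 := by
      rw [norm_mul, RCLike.norm_conj, hp.2.1, hx.2.1, mul_one]
    generalize conj p.2.2 * x.2.2 = u at *
    -- Equality in the triangle inequality puts u on the ray of 1.
    have h6 : ‖1 + u‖ = ‖(1 : ℂ)‖ + ‖u‖ := by
      have : (8 : ℂ) + u * ((8 - 0 ^ 2 : ℝ) : ℂ) = 8 * (1 + u) := by push_cast; ring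
      rw [this, norm_mul] at h
      norm_num at h
      rw [hu, norm_one]; linarith
    have h7 := (sameRay_iff_norm_add.2 h6).norm_smul_eq
    rw [hu, norm_one, one_smul, one_smul] at h7
    exact h7
  have h6 : x.2.2 = p.2.2 := by
    linear_combination p.2.2 * h5 - x.2.2 * mul_conj_eq_one_of_norm_eq_one hp.2.1
  refine Prod.ext ?_ (Prod.ext h4 h6)
  rw [hx.1, hp.1, h4, h6]

/-- At a point with |x₃| < 1 the modulus would be constant on the affine disc through it by the
maximum principle, so every boundary point of the disc would equal p, although the third coordinate
varies there. The polynomial is entire, so |b| + |c| ≤ 1 suffices. -/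
theorem eq_of_norm_tetraPeak_ge {p x : ℂ × ℂ × ℂ} (hp : p ∈ tetraTorus)
    (hx : x ∈ closure tetrablock) (h : 16 ≤ ‖tetraPeak p x‖) : x = p := by
  rcases (norm_trd_le_of_mem_closure_tetrablock hx).lt_or_eq with h3 | h3
  · exfalso
    obtain ⟨b, c, hbc, he⟩ := exists_eq_tetraDisc h3
    have hpos : 0 < 1 - ‖x.2.2‖ ^ 2 := by nlinarith [norm_nonneg x.2.2]
    have hle : ‖b‖ + ‖c‖ ≤ 1 := by
      have := norm_add_norm_le_of_mem_closure_tetrablock hx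
      rw [← he] at this
      by_contra! h1
      nlinarith
    have hd : DiffContOnCl ℂ (tetraPeak p ∘ tetraDisc b c) (Metric.ball (0 : ℂ) 1) :=
      ((differentiable_tetraPeak p).comp (differentiable_tetraDisc b c)).diffContOnCl
    have hM : ∀ l ∈ closure (Metric.ball (0 : ℂ) 1), ‖(tetraPeak p ∘ tetraDisc b c) l‖ ≤ 16 :=
      fun l hl => Complex.norm_le_of_forall_mem_frontier_norm_le Metric.isBounded_ball hd
        (fun l hl => by
          rw [frontier_ball _ one_ne_zero, mem_sphere_zero_iff_norm] at hl
          exact norm_tetraPeak_le hp (tetraDisc_mem_tetraTorus hle hl)) hl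
    have hmax : IsMaxOn (norm ∘ (tetraPeak p ∘ tetraDisc b c)) (Metric.ball (0 : ℂ) 1) x.2.2 := by
      intro l hl
      simp only [mem_ofPred_eq, Function.comp_apply]
      rw [← hbc]
      exact (hM l (subset_closure hl)).trans h
    have heq := Complex.norm_eqOn_closure_of_isPreconnected_of_isMaxOn
      (convex_ball (0 : ℂ) 1).isPreconnected Metric.isOpen_ball hd (mem_ball_zero_iff.2 h3) hmax
    have hval : ‖tetraPeak p x‖ = 16 := by
      refine le_antisymm ?_ h
      have := hM _ (subset_closure (mem_ball_zero_iff.2 h3))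
      rwa [Function.comp_apply, ← hbc] at this
    have hpt : ∀ l : ℂ, ‖l‖ = 1 → tetraDisc b c l = p := fun l hl => by
      refine eq_of_norm_tetraPeak_eq hp (tetraDisc_mem_tetraTorus hle hl) ?_
      have := heq (x := l) (by rw [closure_ball _ one_ne_zero, mem_closedBall_zero_iff, hl])
      simp only [Function.comp_apply, Function.const_apply] at this
      rw [this, ← hbc, hval]
    have h1 := congrArg (fun y => y.2.2) ((hpt 1 (by simp)).trans (hpt (-1) (by simp)).symm)
    simp only [tetraDisc] at h1
    norm_num at h1
  · have hx' := mem_tetraTorus_of_norm_trd_eq_one hx h3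
    exact eq_of_norm_tetraPeak_eq hp hx' (le_antisymm (norm_tetraPeak_le hp hx') h)

theorem tetraBoundary_eq : tetraBoundary = tetraTorus := by
  refine subset_antisymm (sInter_subset_of_mem isClosedBoundary_tetraTorus) ?_
  intro p hp C hC
  obtain ⟨c, hc, hmax⟩ := hC.2.2 (tetraPeak p) (differentiable_tetraPeak p).diffContOnCl
  have h := hmax p (tetraTorus_subset_closure_tetrablock hp)
  rw [norm_tetraPeak_self hp] at h
  rwa [← eq_of_norm_tetraPeak_ge hp (hC.2.1 hc) h]

/-! ### The fundamental group of the distinguished boundary -/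


theorem ContinuousMap.HomotopyEquiv.fundamentalGroup_map_bijective {X Y : Type*}
    [TopologicalSpace X] [TopologicalSpace Y] (e : X ≃ₕ Y) (x : X) :
    Function.Bijective (FundamentalGroup.map e.toFun x) :=
  ((FundamentalGroupoidFunctor.equivOfHomotopyEquiv e).fullyFaithfulFunctor.homEquiv
    (X := FundamentalGroupoid.mk x) (Y := FundamentalGroupoid.mk x)).bijective

/-- The integers as the group of multiples of `2 * π`. -/
noncomputable def intEquivZMultiplesTwoPi : ℤ ≃+ AddSubgroup.zmultiples (2 * Real.pi) :=
  AddEquiv.ofBijective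
    ((zmultiplesHom ℝ (2 * Real.pi)).codRestrict (AddSubgroup.zmultiples (2 * Real.pi))
      fun n => ⟨n, rfl⟩)
    ⟨fun m n h => by
      have : m • (2 * Real.pi) = n • (2 * Real.pi) := congrArg Subtype.val h
      simpa [Real.pi_ne_zero] using this,
    fun ⟨_, n, hn⟩ => ⟨n, Subtype.ext hn⟩⟩

theorem coe_intEquivZMultiplesTwoPi (n : ℤ) :
    (intEquivZMultiplesTwoPi n : ℝ) = n * (2 * Real.pi) := by
  rw [← zsmul_eq_mul]
  rfl

/-- The fundamental group of the circle is `ℤ`, by the total change of the angle. -/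
theorem Circle.exists_fundamentalGroup_mulEquiv (x : Circle) :
    ∃ φ : FundamentalGroup Circle x ≃* Multiplicative ℤ,
      ∀ (γ : Path x x) (Γ : C(I, ℝ)) (m : ℤ), (∀ t, Circle.exp (Γ t) = γ t) →
        Γ 1 = Γ 0 + m * (2 * Real.pi) →
        φ (FundamentalGroup.fromPath (Path.Homotopic.Quotient.mk γ)) = Multiplicative.ofAdd m := by
  obtain ⟨e, he⟩ := (⟨_, Circle.exp_arg x⟩ : ∃ e, Circle.exp e = x)
  let e' : Circle.exp ⁻¹' {x} := ⟨e, he⟩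
  let Φ := Circle.isAddQuotientCoveringMap_exp.fundamentalGroupEquiv e'
  let Ψ : (Multiplicative (AddSubgroup.zmultiples (2 * Real.pi)))ᵐᵒᵖ ≃* Multiplicative ℤ :=
    { MulOpposite.opEquiv.symm.trans intEquivZMultiplesTwoPi.toMultiplicative.symm.toEquiv with
      map_mul' := fun a b => by
        simp [mul_comm] }
  refine ⟨Φ.trans Ψ, fun γ Γ m hΓ hm => ?_⟩
  have h : Φ (FundamentalGroup.fromPath (Path.Homotopic.Quotient.mk γ))
      = MulOpposite.op (Multiplicative.ofAdd (intEquivZMultiplesTwoPi m)) := by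
    refine (Circle.isAddQuotientCoveringMap_exp.fundamentalGroupToMulOpposite_apply_eq_Iff).2 ?_
    -- The angles `e` and `Γ 0` belong to the same point, so translating `Γ` by their difference
    -- gives the lift that starts at `e`.
    have hexp : Circle.exp (e - Γ 0) = 1 := by
      rw [Circle.exp_sub, he, hΓ 0, γ.source]; simp
    have hlift : (Γ + ContinuousMap.const I (e - Γ 0) : C(I, ℝ))
        = Circle.isCoveringMap_exp.liftPath γ e (γ.source.trans he.symm) := by
      rw [Circle.isCoveringMap_exp.eq_liftPath_iff']
      refine ⟨?_, by simp⟩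
      ext t
      simp [Circle.exp_add, hΓ, hexp]
    have h1 := congrArg (fun f : C(I, ℝ) => f 1) hlift
    have h2 : ((intEquivZMultiplesTwoPi m : ℝ) + e : ℝ)
        = Circle.isCoveringMap_exp.liftPath γ e (γ.source.trans he.symm) 1 := by
      rw [← h1, coe_intEquivZMultiplesTwoPi]
      simp only [ContinuousMap.add_apply, ContinuousMap.const_apply, hm]
      ring
    exact h2
  change Ψ (Φ _) = _
  rw [h]
  change Multiplicative.ofAdd (intEquivZMultiplesTwoPi.symm (intEquivZMultiplesTwoPi m)) = _
  rw [AddEquiv.symm_apply_apply]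

theorem mem_tetraTorus_of_mem_tetraBoundary (x : tetraBoundary) : (x : ℂ × ℂ × ℂ) ∈ tetraTorus :=
  tetraBoundary_eq ▸ x.2

/-- The third coordinate on the distinguished boundary. -/
noncomputable def tetraThird : C(tetraBoundary, Circle) where
  toFun x := ⟨(x : ℂ × ℂ × ℂ).2.2,
    mem_sphere_zero_iff_norm.2 (mem_tetraTorus_of_mem_tetraBoundary x).2.1⟩
  continuous_toFun := by fun_prop

/-- The central circle of the distinguished boundary. -/
noncomputable def tetraCore : C(Circle, tetraBoundary) where
  toFun z := ⟨(0, 0, (z : ℂ)), by 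
    rw [tetraBoundary_eq]
    exact ⟨by simp, Circle.norm_coe z, by simp⟩⟩
  continuous_toFun := by fun_prop

/-- The contraction of the distinguished boundary to its central circle. -/
noncomputable def tetraShrink : (tetraCore.comp tetraThird).Homotopy (ContinuousMap.id _) where
  toFun p := ⟨(((p.1 : ℝ) : ℂ) * (p.2 : ℂ × ℂ × ℂ).1, ((p.1 : ℝ) : ℂ) * (p.2 : ℂ × ℂ × ℂ).2.1,
    (p.2 : ℂ × ℂ × ℂ).2.2), by
      have h := mem_tetraTorus_of_mem_tetraBoundary p.2
      refine tetraBoundary_eq.ge ⟨?_, h.2.1, ?_⟩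
      · simp only [map_mul, conj_ofReal]
        rw [h.1]; ring
      · simp only [norm_mul, norm_real, Real.norm_of_nonneg p.1.2.1]
        exact mul_le_one₀ p.1.2.2 (norm_nonneg _) h.2.2⟩
  continuous_toFun := by fun_prop
  map_zero_left x := by 
    refine Subtype.ext (Prod.ext ?_ (Prod.ext ?_ rfl)) <;> simp [tetraCore]
  map_one_left x := by ext <;> simp

/-- The distinguished boundary is homotopy equivalent to the circle. -/
noncomputable def tetraHomotopyEquiv : tetraBoundary ≃ₕ Circle where
  toFun := tetraThird
  invFun := tetraCore
  left_inv := ⟨tetraShrink⟩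
  right_inv := by
    have : tetraThird.comp tetraCore = ContinuousMap.id _ := by
      ext z; rfl
    rw [this]

/-- An isomorphism preserves divisibility by an integer, so m and n divide each other. This makes
the degree independent of the identification with ℤ. -/
theorem natCast_eq_of_multiplicative_int_mulEquiv (φ : Multiplicative ℤ ≃* Multiplicative ℤ) (m n : ℕ)
    (h : φ (Multiplicative.ofAdd (m : ℤ)) = Multiplicative.ofAdd (n : ℤ)) : m = n := by
  have key : ∀ (φ : Multiplicative ℤ ≃* Multiplicative ℤ) (m n : ℕ),
      φ (Multiplicative.ofAdd (m : ℤ)) = Multiplicative.ofAdd (n : ℤ) → m ∣ n := by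
    intro φ m n h
    have h1 : Multiplicative.ofAdd (m : ℤ) = Multiplicative.ofAdd (1 : ℤ) ^ (m : ℤ) := by
      rw [← ofAdd_zsmul]; simp
    rw [h1, map_zpow] at h
    have h2 := congrArg Multiplicative.toAdd h
    rw [toAdd_zpow, toAdd_ofAdd, smul_eq_mul] at h2
    exact Int.natCast_dvd_natCast.1 ⟨_, h2.symm⟩
  refine Nat.dvd_antisymm (key φ m n h) (key φ.symm n m ?_)
  rw [← h, MulEquiv.symm_apply_apply]

/-- The degree of a loop in the distinguished boundary is the winding number of the third
coordinate. -/
theorem exists_tetraBoundary_mulEquiv (g : C(Circle, tetraBoundary)) (Γ : C(I, ℝ)) (m : ℤ)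
    (hΓ : ∀ t : I, (Circle.exp (Γ t) : ℂ)
      = (g (Circle.exp (2 * Real.pi * (t : ℝ))) : ℂ × ℂ × ℂ).2.2)
    (hm : Γ 1 = Γ 0 + m * (2 * Real.pi)) :
    ∃ φ : FundamentalGroup tetraBoundary (g 1) ≃* Multiplicative ℤ,
      φ (FundamentalGroup.map g 1 circleGenerator) = Multiplicative.ofAdd m := by
  obtain ⟨φ, hφ⟩ := Circle.exists_fundamentalGroup_mulEquiv (tetraThird (g 1))
  refine ⟨(MulEquiv.ofBijective _
    (tetraHomotopyEquiv.fundamentalGroup_map_bijective (g 1))).trans φ, ?_⟩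
  refine hφ ((circleLoop.map g.continuous).map tetraThird.continuous) Γ m (fun t => ?_) hm
  apply Subtype.ext
  rw [hΓ t]
  rfl

/-! ### Conjugate reflection of polynomials -/

theorem conjReflect_mul {m n : ℕ} {f g : ℂ[X]} (hf : f.natDegree ≤ m) (hg : g.natDegree ≤ n) :
    conjReflect (m + n) (f * g) = conjReflect m f * conjReflect n g := by
  rw [conjReflect, Polynomial.map_mul, reflect_mul _ _ (natDegree_map_le.trans hf)
    (natDegree_map_le.trans hg)]
  rfl

theorem conjReflect_C_mul (n : ℕ) (c : ℂ) (f : ℂ[X]) :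
    conjReflect n (C c * f) = C (conj c) * conjReflect n f := by
  rw [conjReflect, Polynomial.map_mul, map_C, reflect_C_mul]
  rfl

theorem conjReflect_conjReflect (n : ℕ) (f : ℂ[X]) : conjReflect n (conjReflect n f) = f := by
  ext k
  simp [conjReflect, coeff_reflect, coeff_map]

theorem natDegree_conjReflect_le {n : ℕ} {f : ℂ[X]} (hf : f.natDegree ≤ n) :
    (conjReflect n f).natDegree ≤ n :=
  (natDegree_reflect_le).trans (max_le le_rfl (natDegree_map_le.trans hf))

theorem eval_conjReflect_of_norm_eq_one {n : ℕ} {f : ℂ[X]} (hf : f.natDegree ≤ n) {z : ℂ}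
    (hz : ‖z‖ = 1) : (conjReflect n f).eval z = z ^ n * conj (f.eval z) := by
  have h0 : z ≠ 0 := norm_pos_iff.1 (by rw [hz]; exact one_pos)
  have h1 : 1 / conj z = z := by
    rw [div_eq_iff (by simpa using h0), mul_conj_eq_one_of_norm_eq_one hz]
  rw [eval_conjReflect n f hf z h0, h1]

theorem norm_eval_conjReflect {n : ℕ} {f : ℂ[X]} (hf : f.natDegree ≤ n) {z : ℂ}
    (hz : ‖z‖ = 1) : ‖(conjReflect n f).eval z‖ = ‖f.eval z‖ := by
  rw [eval_conjReflect_of_norm_eq_one hf hz, norm_mul, norm_pow, hz, one_pow, one_mul,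
    RCLike.norm_conj]

theorem eval_zero_conjReflect (n : ℕ) (f : ℂ[X]) : (conjReflect n f).eval 0 = conj (f.coeff n) := by
  rw [← coeff_zero_eq_eval_zero, conjReflect, coeff_reflect, coeff_map, revAt_le (Nat.zero_le n),
    Nat.sub_zero]

theorem exists_eval_eq_zero_of_eval_conjReflect {n : ℕ} {f : ℂ[X]} (hf : f.natDegree ≤ n)
    {z : ℂ} (hz : z ≠ 0) (h : (conjReflect n f).eval z = 0) : f.eval (1 / conj z) = 0 := by
  rw [eval_conjReflect n f hf z hz] at h
  simpa [hz] using h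

theorem infinite_sphere : {z : ℂ | ‖z‖ = 1}.Infinite := by
  have h : (univ : Set Circle).Infinite :=
    isPreconnected_univ.infinite_of_nontrivial ⟨1, mem_univ _, Circle.exp Real.pi, mem_univ _,
      fun h => by
        have h2 : (1 : ℝ) = -1 := by simpa using congrArg (fun z : Circle => (z : ℂ).re) h
        norm_num at h2⟩
  refine (h.image (f := fun z : Circle => (z : ℂ)) Subtype.val_injective.injOn).mono ?_
  rintro _ ⟨z, -, rfl⟩
  exact Circle.norm_coe z

theorem eq_of_eval_eq_on_circle {p q : ℂ[X]} (h : ∀ z : ℂ, ‖z‖ = 1 → p.eval z = q.eval z) :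
    p = q :=
  eq_of_infinite_eval_eq p q (infinite_sphere.mono h)

theorem eq_conjReflect_iff {n : ℕ} {f g : ℂ[X]} (hg : g.natDegree ≤ n) :
    f = conjReflect n g ↔ ∀ z : ℂ, ‖z‖ = 1 → f.eval z = z ^ n * conj (g.eval z) := by
  constructor
  · rintro rfl z hz
    exact eval_conjReflect_of_norm_eq_one hg hz
  · exact fun h => eq_of_eval_eq_on_circle fun z hz => by
      rw [h z hz, eval_conjReflect_of_norm_eq_one hg hz]

/-- Multiplying by a power of z makes the relation on the circle an identity of polynomials, from
which the high coefficients of f can be read off. -/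
theorem natDegree_le_of_eval_eq {n : ℕ} {f g : ℂ[X]}
    (h : ∀ z : ℂ, ‖z‖ = 1 → f.eval z = z ^ n * conj (g.eval z)) : f.natDegree ≤ n := by
  have h1 : X ^ g.natDegree * f = conjReflect (g.natDegree + n) g :=
    (eq_conjReflect_iff (Nat.le_add_right _ _)).2 fun z hz => by
      rw [eval_mul, eval_pow, eval_X, h z hz]; ring
  rw [natDegree_le_iff_coeff_eq_zero]
  intro j hj
  have h2 := congrArg (fun p => coeff p (g.natDegree + j)) h1
  simp only [coeff_X_pow_mul', Nat.le_add_right, if_true, Nat.add_sub_cancel_left] at h2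
  -- Above the index of reflection `revAt` fixes exponents, so this is a coefficient of g beyond its
  -- degree.
  rw [h2, conjReflect, coeff_reflect, coeff_map, revAt_eq_self_of_lt (by omega),
    coeff_eq_zero_of_natDegree_lt (by omega), map_zero]

theorem exists_norm_eq_one_sq_eq {c : ℂ} (hc : ‖c‖ = 1) : ∃ u : ℂ, ‖u‖ = 1 ∧ u ^ 2 = c := by
  obtain ⟨u, hu⟩ := IsAlgClosed.exists_pow_nat_eq c two_pos
  refine ⟨u, ?_, hu⟩
  have := congrArg norm hu
  rw [norm_pow, hc] at this
  exact (pow_eq_one_iff_of_nonneg (norm_nonneg u) two_ne_zero).1 this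

theorem isCoprime_of_forall_eval_ne_zero {p q : ℂ[X]}
    (h : ∀ z : ℂ, p.eval z = 0 → q.eval z ≠ 0) : IsCoprime p q := by
  rw [Polynomial.isCoprime_iff_aeval_ne_zero_of_isAlgClosed ℂ ℂ]
  intro z
  by_cases hz : p.eval z = 0
  · right; simpa using h z hz
  · left; simpa using hz

/-- A polynomial without zeros in the closed disc has its reflection's zeros in the open disc. -/
theorem eval_conjReflect_ne_zero {n : ℕ} {q : ℂ[X]} (hn : q.natDegree ≤ n)
    (hq : ∀ z ∈ closedUnitDisc, q.eval z ≠ 0) {z : ℂ} (hz : 1 ≤ ‖z‖) :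
    (conjReflect n q).eval z ≠ 0 := by
  have h0 : z ≠ 0 := norm_pos_iff.1 (by linarith)
  intro h
  refine hq _ ?_ (exists_eval_eq_zero_of_eval_conjReflect hn h0 h)
  rw [mem_closedBall_zero_iff, norm_div, norm_one, RCLike.norm_conj]
  exact div_le_one_of_le₀ hz (norm_nonneg _)

theorem isCoprime_conjReflect {n : ℕ} {p q : ℂ[X]} (hn : q.natDegree ≤ n)
    (hp : ∀ z ∈ closedUnitDisc, p.eval z ≠ 0) (hq : ∀ z ∈ closedUnitDisc, q.eval z ≠ 0) :
    IsCoprime p (conjReflect n q) :=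
  isCoprime_of_forall_eval_ne_zero fun z hz => eval_conjReflect_ne_zero hn hq <| by
    by_contra! h
    exact hp z (mem_closedBall_zero_iff.2 h.le) hz

/-- A quotient of coprime polynomials that is unimodular on the circle is a constant multiple of
`q^∼ / q`. -/
theorem exists_eq_C_mul_conjReflect {p q : ℂ[X]} (hpq : IsCoprime p q)
    (hq : ∀ z ∈ closedUnitDisc, q.eval z ≠ 0) (h : ∀ z : ℂ, ‖z‖ = 1 → ‖p.eval z‖ = ‖q.eval z‖) :
    ∃ N : ℕ, q.natDegree ≤ N ∧ ∃ c : ℂ, ‖c‖ = 1 ∧ p = C c * conjReflect N q := by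
  set N := max p.natDegree q.natDegree with hN
  have hpN : p.natDegree ≤ N := le_max_left _ _
  have hqN : q.natDegree ≤ N := le_max_right _ _
  -- This is |p|² = |q|² on the circle, multiplied by z^N.
  have hmul : p * conjReflect N p = q * conjReflect N q := eq_of_eval_eq_on_circle fun z hz => by
    rw [eval_mul, eval_mul, eval_conjReflect_of_norm_eq_one hpN hz,
      eval_conjReflect_of_norm_eq_one hqN hz, mul_left_comm, mul_left_comm (q.eval z), mul_conj',
      mul_conj', h z hz]
  have hq0 : q ≠ 0 := fun h0 => hq 0 (by simp) (by simp [h0])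
  obtain ⟨k, hk⟩ : q ∣ conjReflect N p := hpq.symm.dvd_of_dvd_mul_left (Dvd.intro _ hmul.symm)
  have hk2 : p * k = conjReflect N q := mul_left_cancel₀ hq0 (by rw [← hmul, hk]; ring)
  -- A zero of k is common to p^∼ and q^∼. If nonzero, its mirror image is common to p and q; at 0,
  -- both coefficients of index N vanish, which the choice of N as the larger degree excludes.
  have hkroot : ∀ z, k.eval z ≠ 0 := by
    intro z hz
    have h1 : (conjReflect N p).eval z = 0 := by rw [hk, eval_mul, hz, mul_zero]
    have h2 : (conjReflect N q).eval z = 0 := by rw [← hk2, eval_mul, hz, mul_zero]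
    by_cases hz0 : z = 0
    · rw [hz0, eval_zero_conjReflect, map_eq_zero] at h1 h2
      rcases max_choice p.natDegree q.natDegree with hm | hm
      · rw [← hN] at hm
        rw [hm, coeff_natDegree, leadingCoeff_eq_zero] at h1
        rw [h1, natDegree_zero] at hm
        rw [hm] at hqN
        rw [hm, ← Nat.le_zero.1 hqN, coeff_natDegree, leadingCoeff_eq_zero] at h2
        exact hq0 h2
      · rw [← hN] at hm
        rw [hm, coeff_natDegree, leadingCoeff_eq_zero] at h2
        exact hq0 h2
    · obtain ⟨a, b, hab⟩ := hpq
      have := congrArg (eval (1 / conj z)) hab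
      simp [-one_div, exists_eval_eq_zero_of_eval_conjReflect hpN hz0 h1,
        exists_eval_eq_zero_of_eval_conjReflect hqN hz0 h2] at this
  obtain ⟨c, rfl⟩ : ∃ c, k = C c := by
    refine ⟨k.coeff 0, eq_C_of_degree_le_zero ?_⟩
    by_contra! hd
    obtain ⟨z, hz⟩ := IsAlgClosed.exists_root k hd.ne'
    exact hkroot z hz
  refine ⟨N, hqN, conj c, ?_, ?_⟩
  · have h1 := norm_eval_conjReflect hpN norm_one
    rw [hk, eval_mul, eval_C, h 1 norm_one, norm_mul] at h1
    rw [RCLike.norm_conj]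
    have h2 : ‖q.eval 1‖ ≠ 0 := norm_ne_zero_iff.2 (hq 1 (by simp))
    exact mul_left_cancel₀ h2 (by rw [h1, mul_one])
  · rw [← conjReflect_C_mul, mul_comm (C c), ← hk, conjReflect_conjReflect]

/-! ### Rational functions on the disc -/

theorem closure_unitDisc : closure unitDisc = closedUnitDisc := closure_ball 0 one_ne_zero

theorem norm_eval_le_on_closedUnitDisc {p q : ℂ[X]}
    (h : ∀ z ∈ unitDisc, ‖p.eval z‖ ≤ ‖q.eval z‖) {z : ℂ} (hz : z ∈ closedUnitDisc) :
    ‖p.eval z‖ ≤ ‖q.eval z‖ := by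
  rw [← closure_unitDisc] at hz
  exact le_on_closure h p.continuous.norm.continuousOn q.continuous.norm.continuousOn hz

/-- Boundedness removes poles on the circle: |p| ≤ |q| extends to the closed disc, so a zero of q
there would be shared by p. -/
theorem IsRationalOnDisc.exists_isCoprime {f : ℂ → ℂ} (hf : IsRationalOnDisc f)
    (hb : ∀ z ∈ unitDisc, ‖f z‖ ≤ 1) :
    ∃ p q : ℂ[X], IsCoprime p q ∧ (∀ z ∈ closedUnitDisc, q.eval z ≠ 0) ∧
      ∀ z ∈ unitDisc, f z = p.eval z / q.eval z := by
  obtain ⟨p, q, h⟩ := hf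
  have hq0 : q ≠ 0 := fun h0 => (h 0 (by simp)).1 (by simp [h0])
  have hg : EuclideanDomain.gcd p q ≠ 0 := fun h0 => hq0 (EuclideanDomain.gcd_eq_zero_iff.1 h0).2
  obtain ⟨p', hp'⟩ := EuclideanDomain.gcd_dvd_left p q
  obtain ⟨q', hq'⟩ := EuclideanDomain.gcd_dvd_right p q
  have hco : IsCoprime p' q' := by
    have h1 := EuclideanDomain.gcd_eq_gcd_ab p q
    refine ⟨EuclideanDomain.gcdA p q, EuclideanDomain.gcdB p q, mul_left_cancel₀ hg ?_⟩
    conv_rhs => rw [mul_one, h1]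
    linear_combination -EuclideanDomain.gcdA p q * hp' - EuclideanDomain.gcdB p q * hq'
  have hd : ∀ z ∈ unitDisc, q'.eval z ≠ 0 ∧ f z = p'.eval z / q'.eval z := by
    intro z hz
    obtain ⟨h1, h2⟩ := h z hz
    rw [hq', eval_mul] at h1
    refine ⟨right_ne_zero_of_mul h1, ?_⟩
    have h3 := congrArg (eval z) hp'
    have h4 := congrArg (eval z) hq'
    rw [eval_mul] at h3 h4
    rw [h2, h3, h4, mul_div_mul_left _ _ (left_ne_zero_of_mul h1)]
  refine ⟨p', q', hco, fun z hz h0 => ?_, fun z hz => (hd z hz).2⟩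
  have hle := norm_eval_le_on_closedUnitDisc (p := p') (q := q') (fun z hz => by
    have := hb z hz
    rwa [(hd z hz).2, norm_div, div_le_one (norm_pos_iff.2 (hd z hz).1)] at this) hz
  rw [h0, norm_zero, norm_le_zero_iff] at hle
  obtain ⟨a, b, hab⟩ := hco
  have := congrArg (eval z) hab
  simp [hle, h0] at this

theorem extensionEqOnClosedDisc_of_eq_div {f : ℂ → ℂ} {p q : ℂ[X]}
    (hq : ∀ z ∈ closedUnitDisc, q.eval z ≠ 0) (h : ∀ z ∈ unitDisc, f z = p.eval z / q.eval z) :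
    ExtensionEqOnClosedDisc f (fun z => p.eval z / q.eval z) := by
  intro z hz
  have h1 : Tendsto (fun z => p.eval z / q.eval z) (𝓝[unitDisc] z) (𝓝 (p.eval z / q.eval z)) :=
    (p.continuous.continuousAt.div q.continuous.continuousAt (hq z hz)).tendsto.mono_left
      nhdsWithin_le_nhds
  exact h1.congr' (eventually_nhdsWithin_of_forall fun w hw => (h w hw).symm)

theorem ExtensionEqOnClosedDisc.eq_on_unitDisc {f g : ℂ → ℂ} (h : ExtensionEqOnClosedDisc f g)
    {z : ℂ} (hz : z ∈ unitDisc) : f z = g z :=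
  tendsto_nhds_unique (tendsto_pure_nhds f z)
    ((h z (Metric.ball_subset_closedBall hz)).mono_left (pure_le_nhdsWithin hz))

theorem tendsto_radial {z : ℂ} (hz : ‖z‖ = 1) :
    Tendsto (fun r : ℝ => (r : ℂ) * z) (𝓝[<] 1) (𝓝[unitDisc] z) := by
  refine tendsto_nhdsWithin_iff.2 ⟨?_, ?_⟩
  · have : Continuous fun r : ℝ => (r : ℂ) * z := by fun_prop
    have h := this.tendsto 1
    rw [ofReal_one, one_mul] at h
    exact h.mono_left nhdsWithin_le_nhds
  · filter_upwards [Ioo_mem_nhdsLT (zero_lt_one' ℝ)] with r hr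
    rw [mem_ball_zero_iff, norm_mul, hz, mul_one, norm_real, Real.norm_of_nonneg hr.1.le]
    exact hr.2

/-- A continuous logarithm on the closed disc. -/
theorem exists_continuous_exp_eq {D : ℂ[X]} (hD : ∀ z ∈ closedUnitDisc, D.eval z ≠ 0) :
    ∃ L : ℂ → ℂ, Continuous L ∧ ∀ z : ℂ, ‖z‖ = 1 → Complex.exp (L z) = D.eval z := by
  -- The retraction z / max(1, |z|) extends D from the closed disc to a zero-free function on the
  -- simply connected plane.
  have hmem : ∀ z : ℂ, z / (max 1 ‖z‖ : ℝ) ∈ closedUnitDisc := fun z => by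
    have : (0 : ℝ) < max 1 ‖z‖ := lt_max_of_lt_left one_pos
    rw [mem_closedBall_zero_iff, norm_div, norm_real, Real.norm_of_nonneg this.le]
    exact div_le_one_of_le₀ (le_max_right _ _) this.le
  have hc : Continuous fun z : ℂ => D.eval (z / (max 1 ‖z‖ : ℝ)) := by
    refine D.continuous.comp (continuous_id.div (by fun_prop) fun z => ?_)
    have : (0 : ℝ) < max 1 ‖z‖ := lt_max_of_lt_left one_pos
    exact_mod_cast this.ne'
  have hu : ContractibleSpace (univ : Set ℂ) := convex_univ.contractibleSpace univ_nonempty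
  obtain ⟨L, hL, hexp⟩ := Complex.exists_continuousOn_eqOn_exp_comp (X := ℂ) (U := univ)
    (inferInstanceAs (SimplyConnectedSpace (univ : Set ℂ))) isOpen_univ hc.continuousOn (by
      rintro ⟨z, -, hz⟩
      exact hD _ (hmem z) hz)
  refine ⟨L, continuousOn_univ.1 hL, fun z hz => ?_⟩
  have := hexp (mem_univ z)
  simpa [hz] using this

/-! ### Rational tetra-inner functions from polynomials -/

/-- Polynomials whose quotients define a rational tetra-inner function of degree `n`. -/
structure IsTetraTriple (n : ℕ) (E₁ E₂ D : ℂ[X]) : Prop where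
  natDegree_E₂_le : E₂.natDegree ≤ n
  natDegree_D_le : D.natDegree ≤ n
  D_ne_zero : ∀ z ∈ closedUnitDisc, D.eval z ≠ 0
  norm_E₁_le : ∀ z ∈ closedUnitDisc, ‖E₁.eval z‖ ≤ ‖D.eval z‖
  norm_E₂_le : ∀ z ∈ closedUnitDisc, ‖E₂.eval z‖ ≤ ‖D.eval z‖
  E₁_eq : E₁ = conjReflect n E₂

/-- The quotients of the polynomials `E₁, E₂, D^∼` by `D`. -/
noncomputable def tetraQuotient (n : ℕ) (E₁ E₂ D : ℂ[X]) (z : ℂ) : ℂ × ℂ × ℂ :=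
  (E₁.eval z / D.eval z, E₂.eval z / D.eval z, (conjReflect n D).eval z / D.eval z)

namespace IsTetraTriple

variable {n : ℕ} {E₁ E₂ D : ℂ[X]} (h : IsTetraTriple n E₁ E₂ D)
include h

theorem continuousAt_tetraQuotient {z : ℂ} (hz : z ∈ closedUnitDisc) :
    ContinuousAt (tetraQuotient n E₁ E₂ D) z := by
  have hD := h.D_ne_zero z hz
  exact (E₁.continuousAt.div D.continuousAt hD).prodMk
    ((E₂.continuousAt.div D.continuousAt hD).prodMk
      ((conjReflect n D).continuousAt.div D.continuousAt hD))

theorem tetraQuotient_mem_tetraTorus {z : ℂ} (hz : ‖z‖ = 1) :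
    tetraQuotient n E₁ E₂ D z ∈ tetraTorus := by
  have hz' : z ∈ closedUnitDisc := mem_closedBall_zero_iff.2 hz.le
  have hD := h.D_ne_zero z hz'
  have hD' : ‖D.eval z‖ ≠ 0 := norm_ne_zero_iff.2 hD
  have hDc : conj (D.eval z) ≠ 0 := by simpa using hD
  refine ⟨?_, ?_, ?_⟩
  · simp only [tetraQuotient]
    rw [h.E₁_eq, eval_conjReflect_of_norm_eq_one h.natDegree_E₂_le hz,
      eval_conjReflect_of_norm_eq_one h.natDegree_D_le hz, map_div₀]
    field_simp
  · simp only [tetraQuotient]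
    rw [norm_div, norm_eval_conjReflect h.natDegree_D_le hz, div_self hD']
  · simp only [tetraQuotient]
    rw [norm_div]
    exact div_le_one_of_le₀ (h.norm_E₂_le z hz') (norm_nonneg _)

/-- For fixed |z| < 1, (x₂ - x₃z)/(1 - x₁z) is holomorphic in the disc variable and bounded by 1 on
the circle, hence inside. Strictness of |z| < 1 keeps the denominator away from zero. -/
theorem tetraQuotient_mem_closure {l : ℂ} (hl : l ∈ unitDisc) :
    tetraQuotient n E₁ E₂ D l ∈ closure tetrablock := by
  have hl' := Metric.ball_subset_closedBall hl
  have hnorm : ∀ l ∈ closedUnitDisc, ‖(tetraQuotient n E₁ E₂ D l).1‖ ≤ 1 := fun l hl => by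
    simp only [tetraQuotient]
    rw [norm_div]
    exact div_le_one_of_le₀ (h.norm_E₁_le l hl) (norm_nonneg _)
  refine mem_closure_tetrablock_of_norm_le (hnorm l hl') fun z hz => ?_
  have hden : ∀ l ∈ closedUnitDisc, D.eval l - E₁.eval l * z ≠ 0 := fun l hl h0 => by
    have h1 := congrArg norm (sub_eq_zero.1 h0)
    rw [norm_mul] at h1
    have h2 := norm_pos_iff.2 (h.D_ne_zero l hl)
    nlinarith [h.norm_E₁_le l hl, norm_nonneg z]
  have hquot : ∀ l ∈ closedUnitDisc,
      ‖(E₂.eval l - (conjReflect n D).eval l * z) / (D.eval l - E₁.eval l * z)‖ ≤ 1 ↔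
      ‖(tetraQuotient n E₁ E₂ D l).2.1 - (tetraQuotient n E₁ E₂ D l).2.2 * z‖
        ≤ ‖1 - (tetraQuotient n E₁ E₂ D l).1 * z‖ := fun l hl => by
    have hD := h.D_ne_zero l hl
    have hD' := norm_pos_iff.2 hD
    have e1 : E₂.eval l - (conjReflect n D).eval l * z
        = D.eval l * ((tetraQuotient n E₁ E₂ D l).2.1 - (tetraQuotient n E₁ E₂ D l).2.2 * z) := by
      simp only [tetraQuotient]; field_simp
    have e2 : D.eval l - E₁.eval l * z = D.eval l * (1 - (tetraQuotient n E₁ E₂ D l).1 * z) := by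
      simp only [tetraQuotient]; field_simp
    rw [norm_div, div_le_one (norm_pos_iff.2 (hden l hl)), e1, e2, norm_mul, norm_mul,
      mul_le_mul_iff_right₀ hD']
  refine (hquot l hl').1 (Complex.norm_le_of_forall_mem_frontier_norm_le (U := unitDisc)
    (f := fun l => (E₂.eval l - (conjReflect n D).eval l * z) / (D.eval l - E₁.eval l * z))
    Metric.isBounded_ball ⟨?_, ?_⟩ ?_ (subset_closure hl))
  · refine DifferentiableOn.div ?_ ?_ fun l hl => hden l (Metric.ball_subset_closedBall hl)
    · exact (E₂.differentiable.sub ((conjReflect n D).differentiable.mul_const z)).differentiableOn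
    · exact (D.differentiable.sub (E₁.differentiable.mul_const z)).differentiableOn
  · rw [closure_unitDisc]
    exact ContinuousOn.div
      (E₂.continuous.sub ((conjReflect n D).continuous.mul continuous_const)).continuousOn
      (D.continuous.sub (E₁.continuous.mul continuous_const)).continuousOn hden
  · intro l hl
    rw [frontier_ball _ one_ne_zero, mem_sphere_zero_iff_norm] at hl
    rw [hquot l (mem_closedBall_zero_iff.2 hl.le)]
    exact norm_sub_mul_le_of_mem_tetraTorus (h.tetraQuotient_mem_tetraTorus hl) hz.le

variable {x : ℂ → ℂ × ℂ × ℂ} (hx : ∀ z ∈ unitDisc, x z = tetraQuotient n E₁ E₂ D z)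
include hx

theorem tendsto_radial {z : ℂ} (hz : ‖z‖ = 1) :
    Tendsto (fun r : ℝ => x (r * z)) (𝓝[<] 1) (𝓝 (tetraQuotient n E₁ E₂ D z)) := by
  have h1 := (h.continuousAt_tetraQuotient (mem_closedBall_zero_iff.2 hz.le)).tendsto.mono_left
    (nhdsWithin_le_nhds (s := unitDisc))
  exact (h1.congr' (eventually_nhdsWithin_of_forall fun w hw => (hx w hw).symm)).comp
    (_root_.tendsto_radial hz)

theorem isRationalTetraInner : IsRationalTetraInner x := by
  have hne := fun z (hz : z ∈ unitDisc) => h.D_ne_zero z (Metric.ball_subset_closedBall hz)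
  refine ⟨⟨?_, ?_, ?_⟩, ⟨E₁, D, ?_⟩, ⟨E₂, D, ?_⟩, ⟨conjReflect n D, D, ?_⟩⟩
  · refine DifferentiableOn.congr ?_ hx
    exact (E₁.differentiable.differentiableOn.div D.differentiable.differentiableOn hne).prodMk
      ((E₂.differentiable.differentiableOn.div D.differentiable.differentiableOn hne).prodMk
      ((conjReflect n D).differentiable.differentiableOn.div D.differentiable.differentiableOn hne))
  · intro z hz
    rw [hx z hz]
    exact h.tetraQuotient_mem_closure hz
  · refine Eventually.of_forall fun θ => ⟨_, ?_, h.tendsto_radial hx (norm_exp_ofReal_mul_I θ)⟩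
    rw [tetraBoundary_eq]
    exact h.tetraQuotient_mem_tetraTorus (norm_exp_ofReal_mul_I θ)
  all_goals
    intro z hz
    refine ⟨hne z hz, ?_⟩
    simp only [hx z hz]
    rfl

/-- On the circle D^∼/D = z^n · conj D / D, with argument nθ - 2 Im L for a continuous logarithm L
of D. As L is single-valued, only nθ contributes to the winding. -/
theorem hasTetraDegree : HasTetraDegree x n := by
  let g : C(Circle, tetraBoundary) :=
    ⟨fun z => ⟨tetraQuotient n E₁ E₂ D z, by
      rw [tetraBoundary_eq]; exact h.tetraQuotient_mem_tetraTorus (Circle.norm_coe z)⟩, by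
      refine Continuous.subtype_mk (continuous_iff_continuousAt.2 fun z => ?_) _
      exact ContinuousAt.comp (f := fun z : Circle => (z : ℂ))
        (h.continuousAt_tetraQuotient (mem_closedBall_zero_iff.2 (Circle.norm_coe z).le))
        (by fun_prop : Continuous fun z : Circle => (z : ℂ)).continuousAt⟩
  refine ⟨g, fun z => h.tendsto_radial hx (Circle.norm_coe z), ?_⟩
  obtain ⟨L, hLc, hL⟩ := exists_continuous_exp_eq h.D_ne_zero
  let Γ : C(I, ℝ) := ⟨fun t => n * (2 * Real.pi * (t : ℝ))
    - 2 * (L (Circle.exp (2 * Real.pi * (t : ℝ)))).im, by fun_prop⟩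
  refine exists_tetraBoundary_mulEquiv g Γ n (fun t => ?_) ?_
  · set ζ := Circle.exp (2 * Real.pi * (t : ℝ)) with hζ
    have hn : ‖(ζ : ℂ)‖ = 1 := Circle.norm_coe ζ
    change _ = (conjReflect n D).eval (ζ : ℂ) / D.eval (ζ : ℂ)
    rw [eval_conjReflect_of_norm_eq_one h.natDegree_D_le hn, ← hL _ hn, ← Complex.exp_conj]
    have h1 : (ζ : ℂ) ^ n = Complex.exp (n * (2 * Real.pi * (t : ℝ) * Complex.I)) := by
      rw [Complex.exp_nat_mul, hζ, Circle.coe_exp]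
      push_cast; rfl
    rw [h1, ← Complex.exp_add, ← Complex.exp_sub, Circle.coe_exp]
    congr 1
    change ((n * (2 * Real.pi * (t : ℝ)) - 2 * (L (ζ : ℂ)).im : ℝ) : ℂ) * Complex.I = _
    have h2 := sub_conj (L ζ)
    push_cast at h2 ⊢
    linear_combination h2
  · simp [Γ]
    ring

end IsTetraTriple

theorem HasTetraDegree.unique {x : ℂ → ℂ × ℂ × ℂ} {m n : ℕ} (hm : HasTetraDegree x m)
    (hn : HasTetraDegree x n) : m = n := by
  obtain ⟨g, hg, φ, hφ⟩ := hm
  obtain ⟨g', hg', ψ, hψ⟩ := hn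
  have : g = g' := by
    ext1 z
    exact Subtype.ext (tendsto_nhds_unique (hg z) (hg' z))
  subst this
  refine natCast_eq_of_multiplicative_int_mulEquiv (φ.symm.trans ψ) m n ?_
  rw [← hφ, MulEquiv.trans_apply, MulEquiv.symm_apply_apply, hψ]

theorem IsTetraRepresentation.isTetraTriple {n : ℕ} {x : ℂ → ℂ × ℂ × ℂ} {E₁ E₂ D : ℂ[X]}
    (h : IsTetraRepresentation n x E₁ E₂ D) : IsTetraTriple n E₁ E₂ D where
  natDegree_E₂_le := h.natDegree_E₂_le
  natDegree_D_le := h.natDegree_D_le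
  D_ne_zero := h.D_ne_zero
  norm_E₁_le := h.norm_E₁_le
  norm_E₂_le := h.norm_E₂_le
  E₁_eq := eq_of_eval_eq_on_circle fun z hz => h.E₁_eq z (mem_closedBall_zero_iff.2 hz.le)

theorem IsTetraTriple.isTetraRepresentation {n : ℕ} {x : ℂ → ℂ × ℂ × ℂ} {E₁ E₂ D : ℂ[X]}
    (h : IsTetraTriple n E₁ E₂ D) (hx : ∀ z ∈ unitDisc, x z = tetraQuotient n E₁ E₂ D z) :
    IsTetraRepresentation n x E₁ E₂ D where
  natDegree_E₁_le := h.E₁_eq ▸ natDegree_conjReflect_le h.natDegree_E₂_le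
  natDegree_E₂_le := h.natDegree_E₂_le
  natDegree_D_le := h.natDegree_D_le
  D_ne_zero := h.D_ne_zero
  x₃_eq := extensionEqOnClosedDisc_of_eq_div h.D_ne_zero fun z hz => by simp only [hx z hz]; rfl
  x₁_eq := extensionEqOnClosedDisc_of_eq_div h.D_ne_zero fun z hz => by simp only [hx z hz]; rfl
  x₂_eq := extensionEqOnClosedDisc_of_eq_div h.D_ne_zero fun z hz => by simp only [hx z hz]; rfl
  norm_E₁_le := h.norm_E₁_le
  norm_E₂_le := h.norm_E₂_le
  E₁_eq z _ := by rw [← h.E₁_eq]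

theorem IsTetraRepresentation.eq_tetraQuotient {n : ℕ} {x : ℂ → ℂ × ℂ × ℂ} {E₁ E₂ D : ℂ[X]}
    (h : IsTetraRepresentation n x E₁ E₂ D) {z : ℂ} (hz : z ∈ unitDisc) :
    x z = tetraQuotient n E₁ E₂ D z :=
  Prod.ext (h.x₁_eq.eq_on_unitDisc hz)
    (Prod.ext (h.x₂_eq.eq_on_unitDisc hz) (h.x₃_eq.eq_on_unitDisc hz))

/-! ### Existence and uniqueness of the representation -/

/-- If `p₁ / q₁ = conj (p₂ / q₂) * D^∼ / D` on the circle, then `D` is a multiple of `q₁`. -/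
theorem dvd_of_eval_div_eq {N : ℕ} {p₁ q₁ p₂ q₂ D : ℂ[X]} (hco : IsCoprime p₁ q₁)
    (hq₁ : ∀ z ∈ closedUnitDisc, q₁.eval z ≠ 0) (hq₂ : ∀ z ∈ closedUnitDisc, q₂.eval z ≠ 0)
    (hD : ∀ z ∈ closedUnitDisc, D.eval z ≠ 0)
    (h : ∀ z : ℂ, ‖z‖ = 1 → p₁.eval z / q₁.eval z
      = conj (p₂.eval z / q₂.eval z) * ((conjReflect N D).eval z / D.eval z)) : q₁ ∣ D := by
  set M := max p₂.natDegree q₂.natDegree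
  have hp₂M : p₂.natDegree ≤ M := le_max_left _ _
  have hq₂M : q₂.natDegree ≤ M := le_max_right _ _
  have hmul : p₁ * D * conjReflect M q₂ = conjReflect M p₂ * conjReflect N D * q₁ :=
    eq_of_eval_eq_on_circle fun z hz => by
      have hz' : z ∈ closedUnitDisc := mem_closedBall_zero_iff.2 hz.le
      have h1 := h z hz
      have h2 : conj (q₂.eval z) ≠ 0 := by simpa using hq₂ z hz'
      have h3 := hq₁ z hz'
      have h4 := hD z hz'
      rw [map_div₀, div_mul_div_comm, div_eq_div_iff h3 (mul_ne_zero h2 h4)] at h1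
      simp only [eval_mul]
      rw [eval_conjReflect_of_norm_eq_one hp₂M hz, eval_conjReflect_of_norm_eq_one hq₂M hz]
      linear_combination z ^ M * h1
  -- q₁ is coprime to p₁, and also to q₂^∼, whose zeros lie in the open disc where q₁ has none.
  have h1 : q₁ ∣ p₁ * (D * conjReflect M q₂) := ⟨_, by rw [← mul_assoc, hmul, mul_comm]⟩
  exact (isCoprime_conjReflect hq₂M hq₁ hq₂).dvd_of_dvd_mul_right
    (hco.symm.dvd_of_dvd_mul_left h1)

theorem norm_eval_le_of_eq_div {f : ℂ → ℂ} {E D : ℂ[X]} (hD : ∀ z ∈ closedUnitDisc, D.eval z ≠ 0)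
    (hf : ∀ z ∈ unitDisc, f z = E.eval z / D.eval z) (hb : ∀ z ∈ unitDisc, ‖f z‖ ≤ 1) :
    ∀ z ∈ closedUnitDisc, ‖E.eval z‖ ≤ ‖D.eval z‖ := fun z hz =>
  norm_eval_le_on_closedUnitDisc (fun w hw => by
    have h := hb w hw
    rwa [hf w hw, norm_div,
      div_le_one (norm_pos_iff.2 (hD w (Metric.ball_subset_closedBall hw)))] at h) hz

theorem exists_isTetraTriple {x : ℂ → ℂ × ℂ × ℂ} (hx : IsRationalTetraInner x)
    {g : ℂ → ℂ × ℂ × ℂ} (hg : ∀ z : ℂ, ‖z‖ = 1 → g z ∈ tetraTorus)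
    (hlim : ∀ z : ℂ, ‖z‖ = 1 → Tendsto (fun r : ℝ => x (r * z)) (𝓝[<] 1) (𝓝 (g z))) :
    ∃ (N : ℕ) (E₁ E₂ D : ℂ[X]), IsTetraTriple N E₁ E₂ D ∧
      ∀ z ∈ unitDisc, x z = tetraQuotient N E₁ E₂ D z := by
  obtain ⟨⟨-, hmaps, -⟩, hr₁, hr₂, hr₃⟩ := hx
  have hb₁ : ∀ z ∈ unitDisc, ‖(x z).1‖ ≤ 1 := fun z hz =>
    norm_fst_le_of_mem_closure_tetrablock (hmaps hz)
  have hb₂ : ∀ z ∈ unitDisc, ‖(x z).2.1‖ ≤ 1 := fun z hz =>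
    norm_snd_le_of_mem_closure_tetrablock (hmaps hz)
  obtain ⟨p₁, q₁, hco₁, hq₁, hx₁⟩ := hr₁.exists_isCoprime hb₁
  obtain ⟨p₂, q₂, hco₂, hq₂, hx₂⟩ := hr₂.exists_isCoprime hb₂
  obtain ⟨p₃, q₃, hco₃, hq₃, hx₃⟩ := hr₃.exists_isCoprime fun z hz =>
    norm_trd_le_of_mem_closure_tetrablock (hmaps hz)
  have hlim' : ∀ {f : ℂ → ℂ} {p q : ℂ[X]}, (∀ z ∈ closedUnitDisc, q.eval z ≠ 0) →
      (∀ z ∈ unitDisc, f z = p.eval z / q.eval z) → ∀ z : ℂ, ‖z‖ = 1 →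
      Tendsto (fun r : ℝ => f (r * z)) (𝓝[<] 1) (𝓝 (p.eval z / q.eval z)) :=
    fun hq hf z hz => (extensionEqOnClosedDisc_of_eq_div hq hf z
      (mem_closedBall_zero_iff.2 hz.le)).comp (tendsto_radial hz)
  have hg₁ : ∀ z : ℂ, ‖z‖ = 1 → (g z).1 = p₁.eval z / q₁.eval z := fun z hz =>
    tendsto_nhds_unique ((continuous_fst.tendsto (g z)).comp (hlim z hz)) (hlim' hq₁ hx₁ z hz)
  have hg₂ : ∀ z : ℂ, ‖z‖ = 1 → (g z).2.1 = p₂.eval z / q₂.eval z := fun z hz =>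
    tendsto_nhds_unique
      (((continuous_fst.comp continuous_snd).tendsto (g z)).comp (hlim z hz)) (hlim' hq₂ hx₂ z hz)
  have hg₃ : ∀ z : ℂ, ‖z‖ = 1 → (g z).2.2 = p₃.eval z / q₃.eval z := fun z hz =>
    tendsto_nhds_unique
      (((continuous_snd.comp continuous_snd).tendsto (g z)).comp (hlim z hz)) (hlim' hq₃ hx₃ z hz)
  obtain ⟨N, hN, c, hc, hp₃⟩ := exists_eq_C_mul_conjReflect hco₃ hq₃ fun z hz => by
    have h1 := (hg z hz).2.1
    rwa [hg₃ z hz, norm_div, div_eq_one_iff_eq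
      (norm_ne_zero_iff.2 (hq₃ z (mem_closedBall_zero_iff.2 hz.le)))] at h1
  obtain ⟨u, hu, huc⟩ := exists_norm_eq_one_sq_eq ((RCLike.norm_conj c).trans hc)
  have hu0 : u ≠ 0 := norm_pos_iff.1 (by rw [hu]; exact one_pos)
  have huu := mul_conj_eq_one_of_norm_eq_one hu
  -- As u² = conj c, conj u / u = c: replacing q₃ by u q₃ absorbs the constant c into the
  -- reflection.
  have hcu : c * u = conj u := by
    have h1 := mul_conj_eq_one_of_norm_eq_one hc
    linear_combination conj u * h1 - c * u * huu + c * conj u * huc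
  set D : ℂ[X] := C u * q₃ with hDdef
  have hDN : D.natDegree ≤ N := (natDegree_C_mul_le _ _).trans hN
  have hD : ∀ z ∈ closedUnitDisc, D.eval z ≠ 0 := fun z hz => by
    rw [hDdef, eval_mul, eval_C]; exact mul_ne_zero hu0 (hq₃ z hz)
  have hquot : ∀ z, p₃.eval z / q₃.eval z = (conjReflect N D).eval z / D.eval z := fun z => by
    rw [hDdef, conjReflect_C_mul, hp₃, eval_mul, eval_mul, eval_mul, eval_C, eval_C, eval_C, ← hcu,
      mul_comm c u, mul_assoc, mul_div_mul_left _ _ hu0]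
  obtain ⟨s, hs⟩ := dvd_of_eval_div_eq hco₁ hq₁ hq₂ hD fun z hz => by
    rw [← hquot, ← hg₁ z hz, ← hg₂ z hz, ← hg₃ z hz]; exact (hg z hz).1
  obtain ⟨t, ht⟩ := dvd_of_eval_div_eq hco₂ hq₂ hq₁ hD fun z hz => by
    rw [← hquot, ← hg₁ z hz, ← hg₂ z hz, ← hg₃ z hz]; exact snd_eq_of_mem_tetraTorus (hg z hz)
  have hquot₁ : ∀ z ∈ closedUnitDisc,
      p₁.eval z / q₁.eval z = (p₁ * s).eval z / D.eval z := fun z hz => by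
    have h1 := hD z hz
    rw [hs, eval_mul] at h1 ⊢
    rw [eval_mul, mul_div_mul_right _ _ (right_ne_zero_of_mul h1)]
  have hquot₂ : ∀ z ∈ closedUnitDisc,
      p₂.eval z / q₂.eval z = (p₂ * t).eval z / D.eval z := fun z hz => by
    have h1 := hD z hz
    rw [ht, eval_mul] at h1 ⊢
    rw [eval_mul, mul_div_mul_right _ _ (right_ne_zero_of_mul h1)]
  have hrel : ∀ z : ℂ, ‖z‖ = 1 → (p₁ * s).eval z = z ^ N * conj ((p₂ * t).eval z) := fun z hz => by
    have hz' : z ∈ closedUnitDisc := mem_closedBall_zero_iff.2 hz.le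
    have h1 := (hg z hz).1
    have h2 := hD z hz'
    have h3 : conj (D.eval z) ≠ 0 := by simpa using h2
    rw [hg₁ z hz, hg₂ z hz, hg₃ z hz, hquot, hquot₁ z hz', hquot₂ z hz',
      eval_conjReflect_of_norm_eq_one hDN hz, map_div₀] at h1
    field_simp at h1
    linear_combination h1
  -- The relation between E₁ and E₂ is symmetric under reflection, and it bounds the degree of E₂ by
  -- N whatever the degree of E₁.
  have hdeg : (p₂ * t).natDegree ≤ N := natDegree_le_of_eval_eq (g := p₁ * s) fun z hz => by
    have h1 : z ^ N * conj (z ^ N) = 1 :=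
      mul_conj_eq_one_of_norm_eq_one (by rw [norm_pow, hz, one_pow])
    rw [hrel z hz, map_mul, conj_conj]
    linear_combination -(p₂ * t).eval z * h1
  have hx₁' : ∀ z ∈ unitDisc, (x z).1 = (p₁ * s).eval z / D.eval z := fun z hz => by
    rw [hx₁ z hz, hquot₁ z (Metric.ball_subset_closedBall hz)]
  have hx₂' : ∀ z ∈ unitDisc, (x z).2.1 = (p₂ * t).eval z / D.eval z := fun z hz => by
    rw [hx₂ z hz, hquot₂ z (Metric.ball_subset_closedBall hz)]
  exact ⟨N, p₁ * s, p₂ * t, D,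
    ⟨hdeg, hDN, hD, norm_eval_le_of_eq_div (f := fun z => (x z).1) hD hx₁' hb₁,
      norm_eval_le_of_eq_div (f := fun z => (x z).2.1) hD hx₂' hb₂,
      (eq_conjReflect_iff hdeg).2 hrel⟩,
    fun z hz => Prod.ext (hx₁' z hz) (Prod.ext (hx₂' z hz) ((hx₃ z hz).trans (hquot z)))⟩

theorem exists_isTetraRepresentation {n : ℕ} {x : ℂ → ℂ × ℂ × ℂ} (hx : IsRationalTetraInner x)
    (hn : HasTetraDegree x n) : ∃ E₁ E₂ D : ℂ[X], IsTetraRepresentation n x E₁ E₂ D := by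
  obtain ⟨g, hg, -⟩ := id hn
  let g' : ℂ → ℂ × ℂ × ℂ := fun z => if hz : ‖z‖ = 1 then
    g ⟨z, mem_sphere_zero_iff_norm.2 hz⟩ else 0
  have hg' : ∀ z (hz : ‖z‖ = 1), g' z = g ⟨z, mem_sphere_zero_iff_norm.2 hz⟩ := fun z hz =>
    dif_pos hz
  obtain ⟨N, E₁, E₂, D, h, hxe⟩ := exists_isTetraTriple hx (g := g')
    (fun z hz => by rw [hg' z hz]; exact mem_tetraTorus_of_mem_tetraBoundary _)
    (fun z hz => by rw [hg' z hz]; exact hg ⟨z, mem_sphere_zero_iff_norm.2 hz⟩)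
  -- The index N found algebraically is itself a degree of x, hence equals n.
  obtain rfl := (h.hasTetraDegree hxe).unique hn
  exact ⟨E₁, E₂, D, h.isTetraRepresentation hxe⟩

theorem IsTetraRepresentation.C_mul {n : ℕ} {x : ℂ → ℂ × ℂ × ℂ} {E₁ E₂ D : ℂ[X]}
    (h : IsTetraRepresentation n x E₁ E₂ D) {t : ℝ} (ht : t ≠ 0) :
    IsTetraRepresentation n x (C (t : ℂ) * E₁) (C (t : ℂ) * E₂) (C (t : ℂ) * D) := by
  have ht' : (t : ℂ) ≠ 0 := ofReal_ne_zero.2 ht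
  have h' := h.isTetraTriple
  refine IsTetraTriple.isTetraRepresentation ⟨(natDegree_C_mul_le _ _).trans h.natDegree_E₂_le,
    (natDegree_C_mul_le _ _).trans h.natDegree_D_le, fun z hz => ?_, fun z hz => ?_, fun z hz => ?_,
    ?_⟩ fun z hz => ?_
  · rw [eval_mul, eval_C]; exact mul_ne_zero ht' (h.D_ne_zero z hz)
  · rw [eval_mul, eval_mul, norm_mul, norm_mul]
    exact mul_le_mul_of_nonneg_left (h.norm_E₁_le z hz) (norm_nonneg _)
  · rw [eval_mul, eval_mul, norm_mul, norm_mul]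
    exact mul_le_mul_of_nonneg_left (h.norm_E₂_le z hz) (norm_nonneg _)
  · rw [conjReflect_C_mul, conj_ofReal, ← h'.E₁_eq]
  · rw [h.eq_tetraQuotient hz]
    simp only [tetraQuotient, conjReflect_C_mul, conj_ofReal, eval_mul, eval_C,
      mul_div_mul_left _ _ ht']

/-- Equality of the third coordinates gives D^∼D' = D'^∼D; coprimality of D and D^∼, and of D' and
D'^∼, makes D and D' divide each other. If D' = cD, then D'^∼ = conj c · D^∼, so c is real. -/
theorem IsTetraRepresentation.exists_eq_C_mul {n : ℕ} {x : ℂ → ℂ × ℂ × ℂ}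
    {E₁ E₂ D E₁' E₂' D' : ℂ[X]} (h : IsTetraRepresentation n x E₁ E₂ D)
    (h' : IsTetraRepresentation n x E₁' E₂' D') :
    ∃ t : ℝ, t ≠ 0 ∧ E₁' = C (t : ℂ) * E₁ ∧ E₂' = C (t : ℂ) * E₂ ∧ D' = C (t : ℂ) * D := by
  have heq : ∀ z ∈ unitDisc, tetraQuotient n E₁ E₂ D z = tetraQuotient n E₁' E₂' D' z :=
    fun z hz => by rw [← h.eq_tetraQuotient hz, ← h'.eq_tetraQuotient hz]
  have hinf : (unitDisc : Set ℂ).Infinite := infinite_of_mem_nhds 0 (Metric.ball_mem_nhds 0 one_pos)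
  have cross : ∀ {p p' : ℂ[X]},
      (∀ z ∈ unitDisc, p.eval z / D.eval z = p'.eval z / D'.eval z) → p * D' = p' * D :=
    fun hp => eq_of_infinite_eval_eq _ _ <| hinf.mono fun z hz => by
      have hz' := Metric.ball_subset_closedBall hz
      have := hp z hz
      rw [div_eq_div_iff (h.D_ne_zero z hz') (h'.D_ne_zero z hz')] at this
      simpa only [mem_ofPred_eq, eval_mul] using this
  have h3 : conjReflect n D * D' = conjReflect n D' * D :=
    cross fun z hz => congrArg (fun y => y.2.2) (heq z hz)
  have h1 : E₁ * D' = E₁' * D := cross fun z hz => congrArg (fun y => y.1) (heq z hz)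
  have h2 : E₂ * D' = E₂' * D := cross fun z hz => congrArg (fun y => y.2.1) (heq z hz)
  have hD0 : D ≠ 0 := fun h0 => h.D_ne_zero 0 (by simp) (by simp [h0])
  have hD0' : D' ≠ 0 := fun h0 => h'.D_ne_zero 0 (by simp) (by simp [h0])
  have hdvd : D ∣ D' := (isCoprime_conjReflect h.natDegree_D_le h.D_ne_zero
    h.D_ne_zero).dvd_of_dvd_mul_left ⟨conjReflect n D', by rw [h3, mul_comm]⟩
  have hdvd' : D' ∣ D := (isCoprime_conjReflect h'.natDegree_D_le h'.D_ne_zero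
    h'.D_ne_zero).dvd_of_dvd_mul_left ⟨conjReflect n D, by rw [← h3, mul_comm]⟩
  obtain ⟨u, hu⟩ := associated_of_dvd_dvd hdvd hdvd'
  obtain ⟨c, hc, hcu⟩ := Polynomial.isUnit_iff.1 u.isUnit
  rw [← hcu, mul_comm] at hu
  have hc0 : c ≠ 0 := hc.ne_zero
  subst hu
  have hcc : conj c = c := by
    have hr0 : conjReflect n D ≠ 0 := fun h0 => hD0 <| by
      rw [← conjReflect_conjReflect n D, h0]; simp [conjReflect]
    rw [conjReflect_C_mul, mul_left_comm, mul_assoc] at h3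
    exact (C_injective (mul_right_cancel₀ (mul_ne_zero hr0 hD0) h3)).symm
  obtain ⟨t, rfl⟩ := conj_eq_iff_real.1 hcc
  refine ⟨t, fun ht => hc0 (by rw [ht, ofReal_zero]), ?_, ?_, rfl⟩
  · exact mul_right_cancel₀ hD0 (by rw [← h1]; ring)
  · exact mul_right_cancel₀ hD0 (by rw [← h2]; ring)

/-! ### Cancellation of common zeros on the circle -/

theorem conjReflect_X_sub_C {a : ℂ} (ha : ‖a‖ = 1) :
    conjReflect 1 (X - C a) = C (-conj a) * (X - C a) :=
  eq_of_eval_eq_on_circle fun z hz => by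
    rw [eval_conjReflect_of_norm_eq_one (natDegree_X_sub_C_le a) hz]
    simp only [eval_sub, eval_X, eval_C, eval_mul, map_sub]
    linear_combination mul_conj_eq_one_of_norm_eq_one hz - mul_conj_eq_one_of_norm_eq_one ha

theorem conjReflect_succ_X_sub_C_mul {a : ℂ} (ha : ‖a‖ = 1) {k : ℕ} {f : ℂ[X]}
    (hf : f.natDegree ≤ k) :
    conjReflect (k + 1) ((X - C a) * f) = (X - C a) * (C (-conj a) * conjReflect k f) := by
  rw [add_comm, conjReflect_mul (natDegree_X_sub_C_le a) hf, conjReflect_X_sub_C ha]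
  ring

theorem norm_eval_le_of_X_sub_C_mul {a : ℂ} (ha : ‖a‖ = 1) {p q : ℂ[X]}
    (h : ∀ z ∈ closedUnitDisc, ‖((X - C a) * p).eval z‖ ≤ ‖((X - C a) * q).eval z‖) :
    ∀ z ∈ closedUnitDisc, ‖p.eval z‖ ≤ ‖q.eval z‖ := fun z hz =>
  norm_eval_le_on_closedUnitDisc (fun w hw => by
    have h1 := h w (Metric.ball_subset_closedBall hw)
    rw [eval_mul, eval_mul, norm_mul, norm_mul] at h1
    refine le_of_mul_le_mul_left h1 (norm_pos_iff.2 ?_)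
    rw [eval_sub, eval_X, eval_C, sub_ne_zero]
    rintro rfl
    exact (mem_ball_zero_iff.1 hw).ne ha) hz

/-- Since |Eᵢ| ≤ |D|, a zero a of D on the circle is a zero of E₁ and E₂. The factor X - a is its
own reflection up to a constant, so it cancels from all three quotients and n drops by one; this is
why only a bound on the degree survives. -/
theorem exists_isTetraTriple_of_ne_zero_on_unitDisc (n : ℕ) : ∀ {E₁ E₂ D : ℂ[X]},
    E₂.natDegree ≤ n → D.natDegree ≤ n →
    (∀ z ∈ closedUnitDisc, ‖E₁.eval z‖ ≤ ‖D.eval z‖) →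
    (∀ z ∈ closedUnitDisc, ‖E₂.eval z‖ ≤ ‖D.eval z‖) →
    E₁ = conjReflect n E₂ → (∀ z ∈ unitDisc, D.eval z ≠ 0) →
    ∃ m ≤ n, ∃ F₁ F₂ G : ℂ[X], IsTetraTriple m F₁ F₂ G ∧
      ∀ z ∈ unitDisc, tetraQuotient n E₁ E₂ D z = tetraQuotient m F₁ F₂ G z := by
  induction n with
  | zero =>
    intro E₁ E₂ D hE₂ hD hb₁ hb₂ hE hne
    refine ⟨0, le_rfl, E₁, E₂, D, ⟨hE₂, hD, fun z hz h0 => ?_, hb₁, hb₂, hE⟩, fun _ _ => rfl⟩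
    rw [eq_C_of_natDegree_le_zero hD, eval_C] at h0
    exact hne 0 (by simp) (by rwa [← coeff_zero_eq_eval_zero])
  | succ k ih =>
    intro E₁ E₂ D hE₂ hD hb₁ hb₂ hE hne
    by_cases hroot : ∀ z ∈ closedUnitDisc, D.eval z ≠ 0
    · exact ⟨k + 1, le_rfl, E₁, E₂, D, ⟨hE₂, hD, hroot, hb₁, hb₂, hE⟩, fun _ _ => rfl⟩
    push Not at hroot
    obtain ⟨a, ha, hDa⟩ := hroot
    have ha1 : ‖a‖ = 1 := (mem_closedBall_zero_iff.1 ha).antisymm <| by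
      by_contra! hlt
      exact hne a (mem_ball_zero_iff.2 hlt) hDa
    have factor : ∀ {p : ℂ[X]}, p.eval a = 0 → p.natDegree ≤ k + 1 →
        ∃ p' : ℂ[X], p = (X - C a) * p' ∧ p'.natDegree ≤ k := fun {p} hp hdeg => by
      obtain ⟨p', rfl⟩ := dvd_iff_isRoot.2 hp
      refine ⟨p', rfl, ?_⟩
      by_cases h0 : p' = 0
      · simp [h0]
      · rw [natDegree_mul (X_sub_C_ne_zero a) h0, natDegree_X_sub_C] at hdeg
        omega
    have hE₂a : E₂.eval a = 0 := by
      have := hb₂ a ha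
      rwa [hDa, norm_zero, norm_le_zero_iff] at this
    obtain ⟨D', rfl, hD'⟩ := factor hDa hD
    obtain ⟨E₂', rfl, hE₂'⟩ := factor hE₂a hE₂
    rw [conjReflect_succ_X_sub_C_mul ha1 hE₂'] at hE
    subst hE
    -- Reflecting X - a leaves the constant -conj a. With u² = -a one has u · (-conj a) = conj u, so
    -- scaling by u restores both reflection relations.
    obtain ⟨u, hu, hua⟩ := exists_norm_eq_one_sq_eq (c := -a) (by rw [norm_neg, ha1])
    have hu0 : u ≠ 0 := norm_pos_iff.1 (by rw [hu]; exact one_pos)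
    have huu := mul_conj_eq_one_of_norm_eq_one hu
    have hcu : u * -conj a = conj u := by
      have h1 := mul_conj_eq_one_of_norm_eq_one ha1
      have h2 : conj u ^ 2 = -conj a := by rw [← map_pow, hua, map_neg]
      linear_combination -u * h2 + conj u * huu
    have hrefl : ∀ f : ℂ[X], C u * (C (-conj a) * conjReflect k f) = conjReflect k (C u * f) :=
      fun f => by rw [conjReflect_C_mul, ← mul_assoc, ← C_mul, hcu]
    have hXa : ∀ z ∈ unitDisc, (X - C a).eval z ≠ 0 := fun z hz => by
      rw [eval_sub, eval_X, eval_C, sub_ne_zero]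
      rintro rfl
      exact (mem_ball_zero_iff.1 hz).ne ha1
    have hscale : ∀ {p q : ℂ[X]},
        (∀ z ∈ closedUnitDisc, ‖((X - C a) * p).eval z‖ ≤ ‖((X - C a) * q).eval z‖) →
        ∀ z ∈ closedUnitDisc, ‖(C u * p).eval z‖ ≤ ‖(C u * q).eval z‖ := fun h z hz => by
      simpa only [eval_mul, eval_C, norm_mul, hu, one_mul] using
        norm_eval_le_of_X_sub_C_mul ha1 h z hz
    obtain ⟨m, hm, F₁, F₂, G, hF, hq⟩ := ih (E₁ := C u * (C (-conj a) * conjReflect k E₂'))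
      (E₂ := C u * E₂') (D := C u * D')
      ((natDegree_C_mul_le _ _).trans hE₂') ((natDegree_C_mul_le _ _).trans hD')
      (hscale hb₁) (hscale hb₂) (hrefl E₂') (fun z hz => by
        have := hne z hz
        rw [eval_mul] at this
        rw [eval_mul, eval_C]
        exact mul_ne_zero hu0 (right_ne_zero_of_mul this))
    refine ⟨m, hm.trans k.le_succ, F₁, F₂, G, hF, fun z hz => ?_⟩
    rw [← hq z hz]
    have hcancel : ∀ p : ℂ[X], ((X - C a) * p).eval z / ((X - C a) * D').eval z
        = (C u * p).eval z / (C u * D').eval z := fun p => by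
      rw [eval_mul, eval_mul, eval_mul, eval_mul, eval_C, mul_div_mul_left _ _ (hXa z hz),
        mul_div_mul_left _ _ hu0]
    simp only [tetraQuotient]
    rw [conjReflect_succ_X_sub_C_mul ha1 hD', hcancel, hcancel, hcancel, hrefl D']

theorem mainTheorem1 (n : ℕ) :
    -- existence, and uniqueness up to a nonzero real factor
    (∀ x : ℂ → ℂ × ℂ × ℂ, IsRationalTetraInner x → HasTetraDegree x n →
      (∃ E₁ E₂ D : ℂ[X], IsTetraRepresentation n x E₁ E₂ D) ∧
      (∀ E₁ E₂ D : ℂ[X], IsTetraRepresentation n x E₁ E₂ D →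
        ∀ E₁' E₂' D' : ℂ[X], IsTetraRepresentation n x E₁' E₂' D' ↔
          ∃ t : ℝ, t ≠ 0 ∧ E₁' = C (t : ℂ) * E₁ ∧ E₂' = C (t : ℂ) * E₂ ∧
            D' = C (t : ℂ) * D)) ∧
    -- the converse
    (∀ E₁ E₂ D : ℂ[X],
      E₁.natDegree ≤ n → E₂.natDegree ≤ n → D.natDegree ≤ n →
      (∀ z ∈ closedUnitDisc, ‖E₁.eval z‖ ≤ ‖D.eval z‖) →
      (∀ z ∈ closedUnitDisc, ‖E₂.eval z‖ ≤ ‖D.eval z‖) →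
      (∀ z ∈ closedUnitDisc, E₁.eval z = (conjReflect n E₂).eval z) →
      (∀ z ∈ unitDisc, D.eval z ≠ 0) →
      ∀ x : ℂ → ℂ × ℂ × ℂ,
        (∀ z ∈ unitDisc, x z = (E₁.eval z / D.eval z, E₂.eval z / D.eval z,
          (conjReflect n D).eval z / D.eval z)) →
        IsRationalTetraInner x ∧ ∃ m ≤ n, HasTetraDegree x m) := by
  refine ⟨fun x hx hn => ⟨exists_isTetraRepresentation hx hn, fun E₁ E₂ D h E₁' E₂' D' =>
    ⟨h.exists_eq_C_mul, ?_⟩⟩, ?_⟩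
  · rintro ⟨t, ht, rfl, rfl, rfl⟩
    exact h.C_mul ht
  · intro E₁ E₂ D _ hE₂ hD hb₁ hb₂ hE hne x hx
    obtain ⟨m, hm, F₁, F₂, G, hF, hq⟩ := exists_isTetraTriple_of_ne_zero_on_unitDisc n hE₂ hD hb₁
      hb₂ (eq_of_eval_eq_on_circle fun z hz => hE z (mem_closedBall_zero_iff.2 hz.le)) hne
    have hx' : ∀ z ∈ unitDisc, x z = tetraQuotient m F₁ F₂ G z := fun z hz =>
      (hx z hz).trans (hq z hz)
    exact ⟨hF.isRationalTetraInner hx', m, hm, hF.hasTetraDegree hx'⟩
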